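/- For an integer $x\ge 1$ and $\alpha\in(0,1]$ let $\zeta_x(s,\alpha)=\sum_{n\ge x}(n+\alpha)^{-s}$ for $\Re s>1$, continued analytically to $s\neq 1$; equivalently $\zeta_x(s,\alpha)=\zeta(s,\alpha)-\sum_{0\le n<x}(n+\alpha)^{-s}$ with $\zeta(s,\alpha)$ the Hurwitz zeta function. Let $$J_x(u,v)=\int_0^1\zeta_x(u,\alpha)\,\zeta_x(v,\alpha)\,d\alpha,$$ $$E=\{(u,v)\in\mathbb{C}^2:\ u+v\in\{2,1,0,-1,-2,\ldots\}\ \text{or}\ u\in\mathbb{Z}\ \text{or}\ v\in\mathbb{Z}\},$$ and for an integer $n$ let $(s)_n=\Gamma(s+n)/\Gamma(s)$ be the Pochhammer symbol, removable singularities being removed, so that $(s)_n=s(s+1)\cdots(s+n-1)$ for $n\ge 0$ and $(s)_{-n}=1/\big((s-1)(s-2)\cdots(s-n)\big)$ for $n\geq 1$. Let $N\ge 1$ and $x\ge 1$ be integers and let $u,v\in\mathbb{C}$ satisfy $-N+1<\Re u<N+1$, $-N+1<\Re v<N+1$ and $(u,v)\notin E$. Then $$J_x(u,v)=\frac{x^{1-u-v}}{u+v-1}+\left[\frac{\Gamma(1-u)}{\Gamma(v)}+\frac{\Gamma(1-v)}{\Gamma(u)}\right]\Gamma(u+v-1)\,\zeta(u+v-1)-S_N(u,v;x)-S_N(v,u;x)-T_N(u,v;x)-T_N(v,u;x),$$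 where $$S_N(u,v;x)=\sum_{n=0}^{N-1}\frac{(u)_n\,x^{n+1-v}}{(1-v)_{n+1}}\,\zeta_x(u+n,1),$$ $$T_N(u,v;x)=\frac{(u)_N\,x^{N+1-v}}{(1-v)_N}\sum_{l=1}^\infty l^{1-u-v}\int_l^\infty\beta^{u+v-2}(x+\beta)^{-u-N}\,d\beta.$$ In addition, for every integer $M\ge 0$, $$\frac{T_N(u,v;x)}{x^{N+1-v}}=\sum_{m=1}^M(-1)^{m-1}\frac{(2-u-v)_{m-1}(u)_{N-m}}{(1-v)_N}\sum_{l=1}^\infty l^{-m}(x+l)^{-u-N+m}$$ $$\qquad+(-1)^M\frac{(2-u-v)_M(u)_{N-M}}{(1-v)_N}\sum_{l=1}^\infty l^{1-u-v}\int_l^\infty\beta^{u+v-M-2}(x+\beta)^{-u-N+M}\,d\beta.$$ All the integrals and all the series over $l$ converge absolutely. -/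

import Mathlib

namespace HurwitzMean

/-- The Pochhammer symbol `(s)_n` for an arbitrary integer `n`: the meromorphic function
`Γ(s + n) / Γ(s)` of `s`, with its removable singularities removed. For `n = k ≥ 0` this is
`s (s + 1) ⋯ (s + k - 1)`, and for `n = -k < 0` it is `1 / ((s - k) (s - k + 1) ⋯ (s - 1))`. -/
noncomputable def poch (s : ℂ) : ℤ → ℂ
  | Int.ofNat k => ∏ j ∈ Finset.range k, (s + j)
  | Int.negSucc k => (∏ j ∈ Finset.range (k + 1), (s - (j + 1)))⁻¹

/-- The modified Hurwitz zeta function `ζ_x(s, α)`, for an integer `x ≥ 0` and `0 < α ≤ 1`: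
the analytic continuation to `s ≠ 1` of `∑_{n ≥ x} (n + α)^{-s}`. On this range of `α` Mathlib's
`hurwitzZeta α s` is the usual Hurwitz zeta function, continuing `∑_{n ≥ 0} (n + α)^{-s}`. -/
noncomputable def modHurwitz (x : ℕ) (s : ℂ) (α : ℝ) : ℂ :=
  HurwitzZeta.hurwitzZeta (α : UnitAddCircle) s
    - ∑ n ∈ Finset.range x, ((n : ℂ) + (α : ℂ)) ^ (-s)

/-- `J_x(u, v) = ∫_0^1 ζ_x(u, α) ζ_x(v, α) dα`. -/
noncomputable def J (x : ℕ) (u v : ℂ) : ℂ :=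
  ∫ α in (0 : ℝ)..1, modHurwitz x u α * modHurwitz x v α

/-- The exceptional set `E`: pairs with `u + v ∈ {2, 1, 0, -1, …}`, or `u ∈ ℤ`, or `v ∈ ℤ`. -/
def exceptional : Set (ℂ × ℂ) :=
  {p | (∃ k : ℤ, k ≤ 2 ∧ p.1 + p.2 = k) ∨ (∃ k : ℤ, p.1 = k) ∨ (∃ k : ℤ, p.2 = k)}

/-- The finite sum `S_N(u, v; x)`. -/
noncomputable def S (N x : ℕ) (u v : ℂ) : ℂ :=
  ∑ n ∈ Finset.range N,
    poch u n * (x : ℂ) ^ ((n : ℂ) + 1 - v) / poch (1 - v) (n + 1) * modHurwitz x (u + n) 1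

/-- The integrand `β^{u+v-M-2} (x + β)^{-u-N+M}`. -/
noncomputable def tailIntegrand (N M x : ℕ) (u v : ℂ) (β : ℝ) : ℂ :=
  (β : ℂ) ^ (u + v - M - 2) * ((x : ℂ) + (β : ℂ)) ^ (-u - N + M)

/-- The term of index `l ≥ 1`, namely `l^{1-u-v} ∫_l^∞ β^{u+v-M-2} (x + β)^{-u-N+M} dβ`. -/
noncomputable def tailTerm (N M x : ℕ) (u v : ℂ) (l : ℕ) : ℂ :=
  (l : ℂ) ^ (1 - u - v) * ∫ β in Set.Ioi (l : ℝ), tailIntegrand N M x u v β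

/-- The remainder `T_N(u, v; x)`; the summation index `l ≥ 1` is written `l + 1` with `l : ℕ`. -/
noncomputable def T (N x : ℕ) (u v : ℂ) : ℂ :=
  poch u N * (x : ℂ) ^ ((N : ℂ) + 1 - v) / poch (1 - v) N * ∑' l : ℕ, tailTerm N 0 x u v (l + 1)

end HurwitzMean

/-! The formula for `J_x(u, v)` is proved first for `Re u, Re v > 1`, and then continued
analytically in each variable in turn.

In the region of convergence write `Z(s, a) = ∑_{n ≥ 0} (n + a)^{-s}` (`hurwitzSeries`), so that
`ζ_x(s, α) = Z(s, x + α)`. The product `P(a) = Z(u, a) Z(v, a)` satisfies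
`P(y) - P(y + 1) = y^{-u} Z(v, y + 1) + y^{-v} Z(u, y + 1) + y^{-u-v}`, and summing over the
translates of `[x, x + 1]` gives `J_x` as the integral of the right-hand side over `(x, ∞)`
(`J_eq_integral_Ioi`). The last term yields `x^{1-u-v} / (u + v - 1)`. In the first, `N`
integrations by parts, with `∂_a Z(s, a) = -s Z(s + 1, a)`, split off `S_N(v, u; x)` and leave a
multiple of `∫_x^∞ y^{N-u} Z(v + N, y + 1) dy` (`integral_Ioi_eq_neg_S_add`). This is the integral
over `(0, ∞)`, a sum of beta integrals equal to `ζ(u+v-1) B(u+v-1, N+1-u)`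
(`integral_Ioi_zero_hurwitzSeries`), minus the integral over `(0, x)`, which is `T_N(v, u; x)` after
the substitution `y = x l / β` in each term (`T_eq_integral`).

For the continuation, the representation of `T_N` as an integral over `(0, x)` shows that it is
holomorphic in either variable. Holomorphy of `J_x` needs bounds for `ζ_x(s, α)` that are uniform in
`α`, which are not part of the construction of the Hurwitz zeta function by theta kernels. They
follow from the continued relation `ζ_x(s, α) = ζ_x(s, 0) - s ∫_0^α ζ_x(s + 1, t) dt` by descending
induction on `Re s` (`regularAt_of_lt`); here the value `0 ^ (-s) = 0` makes `ζ_x(s, 0)` the limit of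
`ζ_x(s, α)` as `α → 0`. For fixed second variable the exceptional values are countable and form a
closed set, so that a disc stays connected when they are removed, and a disc centred on `Re w = 1`
of radius `N` reaches every point of the strip (`J_eq_closedForm_of_right`).

The expansion of `T_N` is `M` further integrations by parts in each tail integral (`mul_tailTerm`),
all convergent because the integrand of every order is `O(β^{Re v - N - 2})`. -/

namespace HurwitzMean

open Filter Topology Set MeasureTheory

/-! ### The Hurwitz series in the half-plane of convergence -/

/-- The Hurwitz series `∑_{n ≥ 0} (n + a)^{-s}`. It is used only for `a > 0` and `Re s > 1`, where
it converges absolutely. -/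
noncomputable def hurwitzSeries (s : ℂ) (a : ℝ) : ℂ :=
  ∑' n : ℕ, (((n : ℝ) + a : ℝ) : ℂ) ^ (-s)

theorem summable_nat_add_rpow {a σ : ℝ} (ha : 0 < a) (hσ : 1 < σ) :
    Summable fun n : ℕ => ((n : ℝ) + a) ^ (-σ) := by
  refine ((Real.summable_one_div_nat_add_rpow a σ).2 hσ).congr fun n => ?_
  have : 0 < (n : ℝ) + a := by positivity
  rw [abs_of_pos this, Real.rpow_neg this.le, one_div]

theorem norm_nat_add_cpow {a : ℝ} (ha : 0 < a) (s : ℂ) (n : ℕ) :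
    ‖(((n : ℝ) + a : ℝ) : ℂ) ^ (-s)‖ = ((n : ℝ) + a) ^ (-s.re) := by
  rw [Complex.norm_cpow_eq_rpow_re_of_pos (by positivity), Complex.neg_re]

theorem summable_nat_add_cpow {a : ℝ} {s : ℂ} (ha : 0 < a) (hs : 1 < s.re) :
    Summable fun n : ℕ => (((n : ℝ) + a : ℝ) : ℂ) ^ (-s) := by
  refine Summable.of_norm ?_
  simp_rw [norm_nat_add_cpow ha]
  exact summable_nat_add_rpow ha hs

theorem norm_hurwitzSeries_le {a : ℝ} {s : ℂ} (ha : 0 < a) (hs : 1 < s.re) :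
    ‖hurwitzSeries s a‖ ≤ ∑' n : ℕ, ((n : ℝ) + a) ^ (-s.re) := by
  refine (norm_tsum_le_tsum_norm ?_).trans_eq ?_ <;> simp_rw [norm_nat_add_cpow ha]
  exact summable_nat_add_rpow ha hs

/-- A bound uniform in `a ≥ b` and in `Re s ≥ σ`. -/
theorem norm_hurwitzSeries_le_of_le {a b σ : ℝ} {s : ℂ} (hb : 1 ≤ b) (hab : b ≤ a) (hσ : 1 < σ)
    (hs : σ ≤ s.re) : ‖hurwitzSeries s a‖ ≤ ∑' n : ℕ, ((n : ℝ) + b) ^ (-σ) := by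
  refine (norm_hurwitzSeries_le (by linarith) (by linarith)).trans ?_
  refine Summable.tsum_le_tsum (fun n => ?_) (summable_nat_add_rpow (by linarith) (by linarith))
    (summable_nat_add_rpow (by linarith) hσ)
  have hn : (0 : ℝ) ≤ n := n.cast_nonneg
  calc ((n : ℝ) + a) ^ (-s.re) ≤ ((n : ℝ) + a) ^ (-σ) :=
        Real.rpow_le_rpow_of_exponent_le (by linarith) (by linarith)
    _ ≤ ((n : ℝ) + b) ^ (-σ) :=
        Real.rpow_le_rpow_of_nonpos (by linarith) (by linarith) (by linarith)

theorem hasDerivAt_rpow_neg_sub_one {σ y : ℝ} (hσ : 1 < σ) (hy : 0 < y) :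
    HasDerivAt (fun t : ℝ => -(t ^ (1 - σ) / (σ - 1))) (y ^ (-σ)) y := by
  have h := ((Real.hasDerivAt_rpow_const (p := 1 - σ) (Or.inl hy.ne')).div_const (σ - 1)).neg
  have h0 : σ - 1 ≠ 0 := by linarith
  have e : -((1 - σ) * y ^ (1 - σ - 1) / (σ - 1)) = y ^ (-σ) := by
    rw [show (1 : ℝ) - σ - 1 = -σ by ring]
    field_simp
    ring
  rw [e] at h
  exact h

/-- Comparison of one term of the series with an integral, in primitive form. -/
theorem rpow_neg_le_sub {σ y : ℝ} (hσ : 1 < σ) (hy : 0 < y) :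
    (y + 1) ^ (-σ) ≤ y ^ (1 - σ) / (σ - 1) - (y + 1) ^ (1 - σ) / (σ - 1) := by
  obtain ⟨c, hc, hc'⟩ := exists_hasDerivAt_eq_slope (fun t : ℝ => -(t ^ (1 - σ) / (σ - 1)))
    (fun t => t ^ (-σ)) (lt_add_one y)
    (fun t ht => (hasDerivAt_rpow_neg_sub_one hσ (hy.trans_le ht.1)).continuousAt.continuousWithinAt)
    (fun t ht => hasDerivAt_rpow_neg_sub_one hσ (hy.trans ht.1))
  have : (y + 1) ^ (-σ) ≤ c ^ (-σ) :=
    Real.rpow_le_rpow_of_nonpos (hy.trans hc.1) hc.2.le (by linarith)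
  rw [hc'] at this
  simp only [add_sub_cancel_left, div_one] at this
  linarith

/-- The decay `O(y^{1-σ})` of the Hurwitz series, which makes the boundary terms at infinity vanish. -/
theorem tsum_rpow_neg_le {σ y : ℝ} (hσ : 1 < σ) (hy : 0 < y) :
    ∑' n : ℕ, ((n : ℝ) + (y + 1)) ^ (-σ) ≤ y ^ (1 - σ) / (σ - 1) := by
  refine Real.tsum_le_of_sum_range_le (fun n => by positivity) fun n => ?_
  have key : ∑ i ∈ Finset.range n, ((i : ℝ) + (y + 1)) ^ (-σ) ≤
      y ^ (1 - σ) / (σ - 1) - ((n : ℝ) + y) ^ (1 - σ) / (σ - 1) := by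
    induction n with
    | zero => simp
    | succ n ih =>
      rw [Finset.sum_range_succ]
      have := rpow_neg_le_sub hσ (y := (n : ℝ) + y) (by positivity)
      push_cast
      rw [show (n : ℝ) + 1 + y = n + y + 1 by ring, ← add_assoc (n : ℝ)]
      linarith
  have : 0 ≤ ((n : ℝ) + y) ^ (1 - σ) / (σ - 1) := by
    have : 0 < σ - 1 := by linarith
    positivity
  linarith

theorem norm_hurwitzSeries_add_one_le {s : ℂ} {y : ℝ} (hs : 1 < s.re) (hy : 0 < y) :
    ‖hurwitzSeries s (y + 1)‖ ≤ y ^ (1 - s.re) / (s.re - 1) :=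
  (norm_hurwitzSeries_le (by linarith) hs).trans (tsum_rpow_neg_le hs hy)

theorem hurwitzSeries_eq_add {s : ℂ} {a : ℝ} (hs : 1 < s.re) (ha : 0 < a) :
    hurwitzSeries s a = (a : ℂ) ^ (-s) + hurwitzSeries s (a + 1) := by
  rw [hurwitzSeries, (summable_nat_add_cpow ha hs).tsum_eq_zero_add]
  congr 1
  · simp
  · refine tsum_congr fun n => ?_
    congr 2
    push_cast
    ring

theorem hasDerivAt_hurwitzSeries {s : ℂ} {a : ℝ} (hs : 1 < s.re) (ha : 0 < a) :
    HasDerivAt (hurwitzSeries s) (-s * hurwitzSeries (s + 1) a) a := by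
  have hs0 : s ≠ 0 := by rintro rfl; simp at hs; linarith
  have h := hasDerivAt_tsum_of_isPreconnected
    (u := fun n : ℕ => ‖s‖ * ((n : ℝ) + a / 2) ^ (-(s.re + 1)))
    (g := fun (n : ℕ) (b : ℝ) => (((n : ℝ) + b : ℝ) : ℂ) ^ (-s))
    (g' := fun (n : ℕ) (b : ℝ) => -s * (((n : ℝ) + b : ℝ) : ℂ) ^ (-(s + 1)))
    (t := Ioi (a / 2)) (y₀ := a) (y := a)
    ((summable_nat_add_rpow (by linarith) (by linarith)).mul_left _) isOpen_Ioi
    isPreconnected_Ioi ?_ ?_ (mem_Ioi.2 (by linarith)) (summable_nat_add_cpow ha hs)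
    (mem_Ioi.2 (by linarith))
  · rw [tsum_mul_left] at h
    exact h
  · intro n b hb
    have hb' : 0 < (n : ℝ) + b := by
      have hb0 : 0 < b := by linarith [mem_Ioi.1 hb]
      positivity
    have h1 := hasDerivAt_ofReal_cpow_const hb'.ne' (neg_ne_zero.2 hs0)
    have h2 := h1.scomp b ((hasDerivAt_id b).const_add (n : ℝ))
    rw [one_smul] at h2
    rw [show -(s + 1) = -s - 1 by ring]
    exact h2
  · intro n b hb
    have hb1 : a / 2 < b := hb
    rw [norm_mul, norm_neg, norm_nat_add_cpow (by linarith), Complex.add_re, Complex.one_re]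
    have hn : (0 : ℝ) ≤ n := n.cast_nonneg
    gcongr ‖s‖ * ?_
    exact Real.rpow_le_rpow_of_nonpos (by linarith) (by linarith) (by linarith)

theorem continuousOn_hurwitzSeries {s : ℂ} (hs : 1 < s.re) :
    ContinuousOn (hurwitzSeries s) (Ioi 0) :=
  fun _ ha => (hasDerivAt_hurwitzSeries hs ha).continuousAt.continuousWithinAt

theorem differentiableOn_hurwitzSeries {a : ℝ} (ha : 1 ≤ a) :
    DifferentiableOn ℂ (fun s => hurwitzSeries s a) {s | 1 < s.re} := by
  intro s hs
  obtain ⟨σ, h1, h2⟩ := exists_between (show (1 : ℝ) < s.re from hs)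
  have hopen : IsOpen {s : ℂ | σ < s.re} := isOpen_lt continuous_const Complex.continuous_re
  have h := Complex.differentiableOn_tsum_of_summable_norm
    (F := fun (n : ℕ) (s : ℂ) => (((n : ℝ) + a : ℝ) : ℂ) ^ (-s))
    (summable_nat_add_rpow (a := a) (by linarith) h1) ?_ hopen ?_
  · exact (h.differentiableAt (hopen.mem_nhds h2)).differentiableWithinAt
  · intro n w _
    have : (((n : ℝ) + a : ℝ) : ℂ) ≠ 0 := by
      have : 0 < (n : ℝ) + a := by positivity
      exact_mod_cast this.ne'
    exact (differentiableAt_id.neg.const_cpow (Or.inl this)).differentiableWithinAt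
  · intro n w hw
    rw [norm_nat_add_cpow (by linarith)]
    have hn : (0 : ℝ) ≤ n := n.cast_nonneg
    have : σ < w.re := hw
    exact Real.rpow_le_rpow_of_exponent_le (by linarith) (by linarith)

/-- At `α = 0` both definitions of the term `n = 0` use `0 ^ s`, whatever its value, so it cancels and
the endpoint needs no exception. -/
theorem modHurwitz_eq_hurwitzSeries {x : ℕ} {s : ℂ} (hs : 1 < s.re) {α : ℝ}
    (hα : α ∈ Icc (0 : ℝ) 1) : modHurwitz x s α = hurwitzSeries s (x + α) := by
  have h := HurwitzZeta.hasSum_hurwitzZeta_of_one_lt_re hα hs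
  rw [modHurwitz, ← h.tsum_eq, ← h.summable.sum_add_tsum_nat_add x, hurwitzSeries]
  simp_rw [one_div, ← Complex.cpow_neg]
  rw [add_sub_cancel_left]
  refine tsum_congr fun n => ?_
  congr 1
  push_cast
  ring

/-! ### Holomorphic parameter integrals and the identity theorem on a punctured disc -/

/-- A locally dominated integral of a function holomorphic in a parameter is holomorphic in that
parameter: Cauchy's estimate bounds the derivative by the same dominating function. -/
theorem differentiableOn_integral_of_dominated {X : Type*} [MeasurableSpace X] {μ : Measure X}
    {F : ℂ → X → ℂ} {U : Set ℂ} (hU : IsOpen U)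
    (hd : ∀ᵐ t ∂μ, DifferentiableOn ℂ (fun s => F s t) U)
    (hm : ∀ s ∈ U, AEStronglyMeasurable (F s) μ)
    (hb : ∀ s ∈ U, ∃ V ∈ 𝓝 s, ∃ bound : X → ℝ, Integrable bound μ ∧
      ∀ᵐ t ∂μ, ∀ w ∈ V, ‖F w t‖ ≤ bound t) :
    DifferentiableOn ℂ (fun s => ∫ t, F s t ∂μ) U := by
  intro s hs
  obtain ⟨V, hV, bound, hbi, hbound⟩ := hb s hs
  obtain ⟨ε, hε, hball⟩ := Metric.mem_nhds_iff.1 (inter_mem hV (hU.mem_nhds hs))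
  obtain ⟨ρ, hρ, rfl⟩ : ∃ ρ > 0, ε = 2 * ρ := ⟨ε / 2, by positivity, by ring⟩
  have hF' : AEStronglyMeasurable (fun t => deriv (fun w => F w t) s) μ := by
    obtain ⟨e, -, he, he0⟩ := exists_seq_strictAnti_tendsto' (α := ℝ) hρ
    have heU : ∀ n, s + (e n : ℂ) ∈ U := fun n => (hball (by
      rw [Metric.mem_ball, dist_self_add_left, Complex.norm_real, Real.norm_eq_abs,
        abs_of_pos (he n).1]
      linarith [(he n).2])).2
    refine aestronglyMeasurable_of_tendsto_ae atTop
      (f := fun n t => (e n : ℂ)⁻¹ * (F (s + e n) t - F s t))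
      (fun n => ((hm _ (heU n)).sub (hm _ hs)).const_mul _) ?_
    filter_upwards [hd] with t ht
    have h := (ht.differentiableAt (hU.mem_nhds hs)).hasDerivAt.tendsto_slope_zero
    have h0 : Tendsto (fun n => (e n : ℂ)) atTop (𝓝[≠] 0) := by
      refine tendsto_nhdsWithin_iff.2 ⟨?_, Eventually.of_forall fun n => ?_⟩
      · exact_mod_cast (Complex.continuous_ofReal.tendsto 0).comp he0
      · exact Complex.ofReal_ne_zero.2 (he n).1.ne'
    exact h.comp h0
  refine (hasDerivAt_integral_of_dominated_loc_of_deriv_le (μ := μ) (F := F)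
    (F' := fun w t => deriv (fun z => F z t) w) (bound := fun t => bound t / ρ)
    (Metric.ball_mem_nhds s hρ) ?_ ?_ hF' ?_ (hbi.div_const ρ) ?_).2.differentiableAt
    |>.differentiableWithinAt
  · filter_upwards [hU.mem_nhds hs] with w hw using hm w hw
  · refine hbi.mono' (hm s hs) ?_
    filter_upwards [hbound] with t ht using ht s (mem_of_mem_nhds hV)
  · filter_upwards [hbound, hd] with t ht htd w hw
    have hsub : Metric.closedBall w ρ ⊆ Metric.ball s (2 * ρ) := fun z hz => by
      rw [Metric.mem_ball] at hw ⊢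
      rw [Metric.mem_closedBall] at hz
      linarith [dist_triangle z w s]
    refine Complex.norm_deriv_le_of_forall_mem_sphere_norm_le hρ ?_ fun z hz =>
      ht z (hball (hsub (Metric.sphere_subset_closedBall hz))).1
    refine DifferentiableOn.diffContOnCl (htd.mono ?_)
    exact (Metric.closure_ball_subset_closedBall.trans hsub).trans fun z hz => (hball hz).2
  · filter_upwards [hd] with t ht w hw
    refine (ht.differentiableAt (hU.mem_nhds (hball ?_).2)).hasDerivAt
    exact Metric.ball_subset_ball (by linarith) hw

/-- The identity theorem on a disc with a countable closed set removed: the punctured disc stays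
connected, so a holomorphic function vanishing on its right half vanishes. -/
theorem eq_zero_of_eq_zero_right {f : ℂ → ℂ} {c : ℂ} {r : ℝ} {S : Set ℂ}
    (hS : S.Countable) (hS' : IsClosed S) (hf : DifferentiableOn ℂ f (Metric.ball c r \ S))
    (h0 : ∀ s ∈ Metric.ball c r \ S, c.re < s.re → f s = 0) {s : ℂ}
    (hs : s ∈ Metric.ball c r \ S) : f s = 0 := by
  have hr : 0 < r := dist_nonneg.trans_lt (Metric.mem_ball.1 hs.1)
  have hopen : IsOpen (Metric.ball c r \ S) := Metric.isOpen_ball.sdiff hS'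
  have hconn : IsPreconnected (Metric.ball c r \ S) := by
    let e := OpenPartialHomeomorph.univBall c r
    have hinj : InjOn e univ := by
      have := e.injOn
      rwa [OpenPartialHomeomorph.univBall_source] at this
    have hcount : (e ⁻¹' S).Countable := hS.preimage_of_injOn (hinj.mono (subset_univ _))
    have h1 := (hcount.isConnected_compl_of_one_lt_rank
      (E := ℂ) (by rw [Complex.rank_real_complex]; norm_num)).isPreconnected
    have h2 := h1.image e (OpenPartialHomeomorph.continuous_univBall c r).continuousOn
    convert h2 using 1
    have himg : e '' univ = Metric.ball c r := by
      have := e.image_source_eq_target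
      rwa [OpenPartialHomeomorph.univBall_source, OpenPartialHomeomorph.univBall_target c hr] at this
    rw [← himg, ← preimage_compl, image_preimage_eq_inter_range, image_univ, inter_comm]
    rfl
  have hV : IsOpen (Metric.ball c r ∩ {w | c.re < w.re}) :=
    Metric.isOpen_ball.inter (isOpen_lt continuous_const Complex.continuous_re)
  obtain ⟨z, hz, hz'⟩ := (hS.dense_compl ℝ).inter_open_nonempty _ hV
    ⟨c + (r / 2 : ℝ), by simp [abs_of_pos hr, hr], by simp [hr]⟩
  have ha := hf.analyticOnNhd hopen
  refine ha.eqOn_of_preconnected_of_eventuallyEq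
    (fun w _ => analyticAt_const (v := (0 : ℂ))) hconn (z₀ := z) ⟨hz.1, hz'⟩ ?_ hs
  filter_upwards [(hV.sdiff hS').mem_nhds ⟨hz, hz'⟩] with w hw
  exact h0 w ⟨hw.1.1, hw.2⟩ hw.1.2

theorem isClosed_image_intCast (K : Set ℤ) : IsClosed ((fun k : ℤ => (k : ℂ)) '' K) := by
  have h : Topology.IsClosedEmbedding (fun k : ℤ => (k : ℂ)) :=
    Complex.isometry_ofReal.isClosedEmbedding.comp Int.isClosedEmbedding_coe_real
  exact h.isClosedMap _ (isClosed_discrete K)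

/-! ### Regularity of `ζ_x(s, α)` in `α` for all non-integral `s` -/

/-- The integers, as a subset of the complex plane. -/
def complexIntegers : Set ℂ := (fun k : ℤ => (k : ℂ)) '' univ

theorem isClosed_complexIntegers : IsClosed complexIntegers := isClosed_image_intCast _

theorem countable_complexIntegers : complexIntegers.Countable := countable_univ.image _

theorem intCast_mem_complexIntegers (k : ℤ) : (k : ℂ) ∈ complexIntegers := ⟨k, mem_univ _, rfl⟩

theorem ne_intCast_of_notMem {s : ℂ} (hs : s ∉ complexIntegers) (k : ℤ) : s ≠ k := by
  rintro rfl; exact hs (intCast_mem_complexIntegers k)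

theorem add_natCast_notMem {s : ℂ} (hs : s ∉ complexIntegers) (n : ℕ) :
    s + n ∉ complexIntegers := by
  rintro ⟨k, -, hk⟩
  refine ne_intCast_of_notMem hs (k - n) ?_
  push_cast
  rw [eq_sub_iff_add_eq]
  exact hk.symm

theorem differentiableAt_modHurwitz (x : ℕ) (α : ℝ) {s : ℂ} (h0 : s ≠ 0) (h1 : s ≠ 1) :
    DifferentiableAt ℂ (fun s => modHurwitz x s α) s := by
  unfold modHurwitz
  refine (HurwitzZeta.differentiableAt_hurwitzZeta _ h1).sub (DifferentiableAt.fun_sum fun n _ => ?_)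
  exact differentiableAt_id.neg.const_cpow (Or.inr (neg_ne_zero.2 h0))

theorem modHurwitz_eq_sub_integral_of_one_lt {x : ℕ} (hx : 1 ≤ x) {s : ℂ} (hs : 1 < s.re) {α : ℝ}
    (hα : α ∈ Icc (0 : ℝ) 1) :
    modHurwitz x s α = modHurwitz x s 0 - s * ∫ t in (0 : ℝ)..α, modHurwitz x (s + 1) t := by
  have hx' : (1 : ℝ) ≤ x := by exact_mod_cast hx
  have hs1 : 1 < (s + 1).re := by simp; linarith
  have hcongr : ∫ t in (0 : ℝ)..α, modHurwitz x (s + 1) t =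
      ∫ t in (0 : ℝ)..α, hurwitzSeries (s + 1) (x + t) := by
    refine intervalIntegral.integral_congr fun t ht => ?_
    rw [uIcc_of_le hα.1] at ht
    exact modHurwitz_eq_hurwitzSeries hs1 ⟨ht.1, ht.2.trans hα.2⟩
  have hpos : ∀ t ∈ uIcc 0 α, 0 < (x : ℝ) + t := fun t ht => by
    rw [uIcc_of_le hα.1] at ht
    linarith [ht.1]
  have hcont : ContinuousOn (fun t : ℝ => -s * hurwitzSeries (s + 1) (x + t)) (uIcc 0 α) :=
    ((continuousOn_hurwitzSeries hs1).comp (by fun_prop) hpos).const_mul _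
  have h := intervalIntegral.integral_eq_sub_of_hasDerivAt
    (f := fun t : ℝ => hurwitzSeries s (x + t))
    (f' := fun t : ℝ => -s * hurwitzSeries (s + 1) (x + t)) (a := 0) (b := α)
    (fun t ht => (hasDerivAt_hurwitzSeries hs (hpos t ht)).comp_const_add (x : ℝ) t)
    hcont.intervalIntegrable
  rw [intervalIntegral.integral_const_mul] at h
  rw [hcongr, modHurwitz_eq_hurwitzSeries hs hα, modHurwitz_eq_hurwitzSeries hs (by simp)]
  linear_combination -h

/-- The regularity of `ζ_x(s, α)` in `α ∈ [0, 1]` that is needed for holomorphy of `J_x`: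
boundedness locally uniformly in `s`, and continuity. -/
def RegularAt (x : ℕ) (s : ℂ) : Prop :=
  (∃ V ∈ 𝓝 s, ∃ C : ℝ, ∀ w ∈ V, ∀ α ∈ Icc (0 : ℝ) 1, ‖modHurwitz x w α‖ ≤ C) ∧
    ContinuousOn (modHurwitz x s) (Icc 0 1)

theorem regularAt_of_one_lt {x : ℕ} (hx : 1 ≤ x) {s : ℂ} (hs : 1 < s.re) : RegularAt x s := by
  have hx' : (1 : ℝ) ≤ x := by exact_mod_cast hx
  constructor
  · obtain ⟨σ, h1, h2⟩ := exists_between hs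
    refine ⟨{w | σ < w.re}, (isOpen_lt continuous_const Complex.continuous_re).mem_nhds h2,
      ∑' n : ℕ, ((n : ℝ) + x) ^ (-σ), fun w hw α hα => ?_⟩
    have hw' : σ < w.re := hw
    rw [modHurwitz_eq_hurwitzSeries (by linarith) hα]
    exact norm_hurwitzSeries_le_of_le hx' (by linarith [hα.1]) h1 hw'.le
  · refine ContinuousOn.congr (f := fun α : ℝ => hurwitzSeries s (x + α)) ?_ fun α hα =>
      modHurwitz_eq_hurwitzSeries hs hα
    refine (continuousOn_hurwitzSeries hs).comp (by fun_prop) fun α hα => ?_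
    exact mem_Ioi.2 (by linarith [hα.1])

theorem differentiableOn_integral_of_regularAt {x : ℕ} {U : Set ℂ} (hU : IsOpen U)
    (hU1 : ∀ s ∈ U, s ∉ complexIntegers) (hreg : ∀ s ∈ U, RegularAt x s) {α : ℝ}
    (hα : α ∈ Icc (0 : ℝ) 1) {g : ℝ → ℂ} (hg : ContinuousOn g (Icc 0 1)) :
    DifferentiableOn ℂ (fun s => ∫ t in (0 : ℝ)..α, modHurwitz x s t * g t) U := by
  have hsub : Ioc 0 α ⊆ Icc (0 : ℝ) 1 := fun t ht => ⟨ht.1.le, ht.2.trans hα.2⟩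
  obtain ⟨D, hD⟩ := isCompact_Icc.exists_bound_of_continuousOn hg
  simp_rw [intervalIntegral.integral_of_le hα.1]
  refine differentiableOn_integral_of_dominated hU ?_ ?_ ?_
  · refine Eventually.of_forall fun t s hs => ?_
    refine ((differentiableAt_modHurwitz x t ?_ ?_).mul_const _).differentiableWithinAt
    · exact_mod_cast ne_intCast_of_notMem (hU1 s hs) 0
    · exact_mod_cast ne_intCast_of_notMem (hU1 s hs) 1
  · exact fun s hs => (((hreg s hs).2.mul hg).mono hsub).aestronglyMeasurable measurableSet_Ioc
  · intro s hs
    obtain ⟨V, hV, C, hC⟩ := (hreg s hs).1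
    refine ⟨V, hV, fun _ => C * D, integrable_const _, ?_⟩
    filter_upwards [ae_restrict_mem measurableSet_Ioc] with t ht w hw
    rw [norm_mul]
    have := hC w hw t (hsub ht)
    exact mul_le_mul this (hD t (hsub ht)) (norm_nonneg _) ((norm_nonneg _).trans this)

/-- The Taylor formula of order one in `α`, continued analytically in `s`. -/
theorem modHurwitz_eq_sub_integral {x : ℕ} (hx : 1 ≤ x) {b : ℝ}
    (hreg : ∀ s ∉ complexIntegers, b + 1 < s.re → RegularAt x s) {s : ℂ}
    (hs : s ∉ complexIntegers) (hsb : b < s.re) {α : ℝ} (hα : α ∈ Icc (0 : ℝ) 1) :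
    modHurwitz x s α = modHurwitz x s 0 - s * ∫ t in (0 : ℝ)..α, modHurwitz x (s + 1) t := by
  -- The disc has its centre in the half-plane of convergence, touches the line `Re w = b`, and
  -- contains `s`.
  set R : ℝ := max 1 s.re
  have hR1 : 1 ≤ R := le_max_left _ _
  have hR2 : s.re ≤ R := le_max_right _ _
  set c : ℂ := ⟨R, s.im⟩
  have hball : ∀ w ∈ Metric.ball c (R - b), b < w.re := fun w hw => by
    rw [Metric.mem_ball, dist_eq_norm] at hw
    have h := (abs_le.1 (Complex.abs_re_le_norm (w - c))).1
    have : (w - c).re = w.re - R := rfl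
    linarith
  have hmem : s ∈ Metric.ball c (R - b) := by
    rw [Metric.mem_ball, Complex.dist_of_im_eq (show s.im = c.im from rfl), Real.dist_eq, abs_sub_comm,
      abs_of_nonneg (sub_nonneg.2 hR2)]
    show R - s.re < R - b
    linarith
  have hshift : IsOpen {w : ℂ | w ∉ complexIntegers ∧ b + 1 < w.re} :=
    isClosed_complexIntegers.isOpen_compl.inter (isOpen_lt continuous_const Complex.continuous_re)
  have hint := differentiableOn_integral_of_regularAt hshift (fun w hw => hw.1)
    (fun w hw => hreg w hw.1 hw.2) hα (continuousOn_const (c := (1 : ℂ)))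
  simp only [mul_one] at hint
  have key := eq_zero_of_eq_zero_right (c := c) (r := R - b) (S := complexIntegers)
    (f := fun w => modHurwitz x w α - (modHurwitz x w 0 -
      w * ∫ t in (0 : ℝ)..α, modHurwitz x (w + 1) t))
    countable_complexIntegers isClosed_complexIntegers ?_ ?_ ⟨hmem, hs⟩
  · exact sub_eq_zero.1 key
  · intro w hw
    have h0 : w ≠ 0 := by exact_mod_cast ne_intCast_of_notMem hw.2 0
    have h1 : w ≠ 1 := by exact_mod_cast ne_intCast_of_notMem hw.2 1
    have hw1 : w + 1 ∈ {w : ℂ | w ∉ complexIntegers ∧ b + 1 < w.re} :=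
      ⟨by exact_mod_cast add_natCast_notMem hw.2 1, by
        have := hball w hw.1
        simp only [Complex.add_re, Complex.one_re]
        linarith⟩
    have h2 : DifferentiableAt ℂ (fun w => ∫ t in (0 : ℝ)..α, modHurwitz x (w + 1) t) w :=
      (hint.differentiableAt (hshift.mem_nhds hw1)).comp w (differentiableAt_id.add_const 1)
    exact ((differentiableAt_modHurwitz x α h0 h1).sub
      ((differentiableAt_modHurwitz x 0 h0 h1).sub
        (differentiableAt_id.mul h2))).differentiableWithinAt
  · intro w _ hw
    exact sub_eq_zero.2 (modHurwitz_eq_sub_integral_of_one_lt hx (hR1.trans_lt hw) hα)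

/-- Each step of the induction moves the boundary of the half-plane by one to the left, since the
continued relation expresses `ζ_x(s, α)` through `ζ_x(s + 1, t)`. -/
theorem regularAt_of_lt {x : ℕ} (hx : 1 ≤ x) (k : ℕ) :
    ∀ s ∉ complexIntegers, 1 - (k : ℝ) < s.re → RegularAt x s := by
  induction k with
  | zero => exact fun s _ hs => regularAt_of_one_lt hx (by simpa using hs)
  | succ k ih =>
    intro s hs hsk
    push_cast at hsk
    have hid := fun (w : ℂ) (hw : w ∉ complexIntegers) (hwk : -(k : ℝ) < w.re) (α : ℝ) hα =>
      modHurwitz_eq_sub_integral hx (b := -(k : ℝ)) (fun s hs h => ih s hs (by linarith)) hw hwk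
        (α := α) hα
    have hreg : RegularAt x (s + 1) := ih _ (by exact_mod_cast add_natCast_notMem hs 1) (by
      simp only [Complex.add_re, Complex.one_re]; linarith)
    constructor
    · obtain ⟨V, hV, C, hC⟩ := hreg.1
      have h0 : ContinuousAt (fun s => modHurwitz x s 0) s :=
        (differentiableAt_modHurwitz x 0 (by exact_mod_cast ne_intCast_of_notMem hs 0)
          (by exact_mod_cast ne_intCast_of_notMem hs 1)).continuousAt
      have hev : ∀ᶠ w in 𝓝 s, ‖modHurwitz x w 0‖ ≤ ‖modHurwitz x s 0‖ + 1 ∧ ‖w‖ ≤ ‖s‖ + 1 ∧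
          w + 1 ∈ V ∧ w ∉ complexIntegers ∧ -(k : ℝ) < w.re := by
        have h3 : ∀ᶠ w in 𝓝 s, w + 1 ∈ V :=
          ContinuousAt.preimage_mem_nhds (f := fun w : ℂ => w + 1) (by fun_prop) hV
        have h4 : ∀ᶠ w in 𝓝 s, w ∉ complexIntegers :=
          isClosed_complexIntegers.isOpen_compl.mem_nhds hs
        have h5 : ∀ᶠ w in 𝓝 s, -(k : ℝ) < w.re :=
          (isOpen_lt continuous_const Complex.continuous_re).mem_nhds (by
            show -(k : ℝ) < s.re
            linarith)
        filter_upwards [h0.norm.eventually_le_const (lt_add_one _),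
          continuous_norm.continuousAt.eventually_le_const (lt_add_one _), h3, h4, h5]
          with w h1 h2 h3 h4 h5 using ⟨h1, h2, h3, h4, h5⟩
      refine ⟨_, hev, ‖modHurwitz x s 0‖ + 1 + (‖s‖ + 1) * C, fun w hw α hα => ?_⟩
      obtain ⟨h1, h2, h3, h4, h5⟩ := hw
      have hI : ‖∫ t in (0 : ℝ)..α, modHurwitz x (w + 1) t‖ ≤ C * |α - 0| := by
        refine intervalIntegral.norm_integral_le_of_norm_le_const fun t ht => ?_
        rw [uIoc_of_le hα.1] at ht
        exact hC _ h3 t ⟨ht.1.le, ht.2.trans hα.2⟩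
      have hC0 : 0 ≤ C := (norm_nonneg _).trans (hC _ h3 0 (by simp))
      rw [sub_zero, abs_of_nonneg hα.1] at hI
      have hI' := hI.trans (mul_le_of_le_one_right hC0 hα.2)
      rw [hid w h4 h5 α hα]
      refine (norm_sub_le _ _).trans (add_le_add h1 ?_)
      rw [norm_mul]
      exact mul_le_mul h2 hI' (norm_nonneg _) (by positivity)
    · refine ContinuousOn.congr (f := fun α : ℝ => modHurwitz x s 0 -
        s * ∫ t in (0 : ℝ)..α, modHurwitz x (s + 1) t) ?_ fun α hα => hid s hs (by linarith) α hα
      refine continuousOn_const.sub (continuousOn_const.mul ?_)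
      have := intervalIntegral.continuousOn_primitive_interval (μ := volume) (a := (0 : ℝ)) (b := 1)
        (f := modHurwitz x (s + 1)) (by
          rw [uIcc_of_le zero_le_one]; exact hreg.2.integrableOn_Icc)
      rwa [uIcc_of_le zero_le_one] at this

theorem regularAt {x : ℕ} (hx : 1 ≤ x) {s : ℂ} (hs : s ∉ complexIntegers) : RegularAt x s := by
  obtain ⟨k, hk⟩ := exists_nat_gt (1 - s.re)
  exact regularAt_of_lt hx k s hs (by linarith)

/-! ### Pochhammer symbols, the tail integrals and the expansion of `T_N` -/

theorem poch_natCast_succ (s : ℂ) (n : ℕ) : poch s ((n : ℤ) + 1) = poch s n * (s + n) :=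
  Finset.prod_range_succ _ _

/-- The functional equation `(s)_{n+1} = (s)_n (s + n)` for all integers `n`, negative ones included. -/
theorem poch_succ {s : ℂ} (hs : s ∉ complexIntegers) (n : ℤ) :
    poch s (n + 1) = poch s n * (s + n) := by
  rcases n with n | k
  · exact poch_natCast_succ s n
  · have hne : s - (k + 1) ≠ 0 := sub_ne_zero.2 (by exact_mod_cast ne_intCast_of_notMem hs (k + 1))
    have hcast : s + ((Int.negSucc k : ℤ) : ℂ) = s - (k + 1) := by
      rw [Int.cast_negSucc]; push_cast; ring
    rw [hcast]
    have hR : poch s (Int.negSucc k) = (∏ j ∈ Finset.range (k + 1), (s - (j + 1)))⁻¹ := rfl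
    rw [hR, Finset.prod_range_succ, mul_inv, mul_assoc, inv_mul_cancel₀ hne, mul_one]
    cases k with
    | zero => simp [poch]
    | succ k => rfl

theorem one_sub_notMem {s : ℂ} (hs : s ∉ complexIntegers) : 1 - s ∉ complexIntegers := by
  rintro ⟨k, -, hk⟩
  refine ne_intCast_of_notMem hs (1 - k) ?_
  have hk' : (k : ℂ) = 1 - s := hk
  push_cast
  rw [hk']
  ring

theorem poch_natCast_ne_zero {s : ℂ} (hs : s ∉ complexIntegers) (n : ℕ) : poch s n ≠ 0 := by
  refine Finset.prod_ne_zero_iff.2 fun j _ => ?_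
  exact_mod_cast ne_intCast_of_notMem (add_natCast_notMem hs j) 0

/-- Unlike `hasDerivAt_ofReal_cpow_const`, this allows the exponent `0`, which does occur in the
expansion of `T_N`, for instance when `u + v = 3` and `M = 1`. -/
theorem hasDerivAt_ofReal_cpow {y : ℝ} (hy : 0 < y) (r : ℂ) :
    HasDerivAt (fun t : ℝ => (t : ℂ) ^ r) (r * (y : ℂ) ^ (r - 1)) y := by
  rcases eq_or_ne r 0 with rfl | hr
  · simpa using hasDerivAt_const y (1 : ℂ)
  · exact hasDerivAt_ofReal_cpow_const hy.ne' hr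

theorem hasDerivAt_natCast_add_cpow (x : ℕ) {y : ℝ} (hy : 0 < y) (r : ℂ) :
    HasDerivAt (fun t : ℝ => ((x : ℂ) + t) ^ r) (r * ((x : ℂ) + y) ^ (r - 1)) y := by
  have h := (hasDerivAt_ofReal_cpow (show 0 < (x : ℝ) + y by positivity) r).comp_const_add (x : ℝ) y
  push_cast at h
  exact h

theorem norm_cpow_mul_add_cpow_le (x : ℕ) (a b : ℂ) {β : ℝ} (hβ : 1 ≤ β) :
    ‖(β : ℂ) ^ a * ((x : ℂ) + β) ^ b‖ ≤ ((x : ℝ) + 1) ^ |b.re| * β ^ (a.re + b.re) := by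
  have hx : (0 : ℝ) ≤ x := x.cast_nonneg
  have hβ0 : 0 < β := by linarith
  have hcast : (x : ℂ) + β = ((x + β : ℝ) : ℂ) := by push_cast; rfl
  rw [norm_mul, hcast, Complex.norm_cpow_eq_rpow_re_of_pos hβ0,
    Complex.norm_cpow_eq_rpow_re_of_pos (by positivity), Real.rpow_add hβ0, mul_left_comm]
  gcongr
  rcases le_or_gt 0 b.re with h | h
  · rw [abs_of_nonneg h, ← Real.mul_rpow (by positivity) hβ0.le]
    exact Real.rpow_le_rpow (by positivity) (by nlinarith) h
  · refine (Real.rpow_le_rpow_of_nonpos hβ0 (by linarith) h.le).trans ?_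
    exact le_mul_of_one_le_left (by positivity) (Real.one_le_rpow (by linarith) (abs_nonneg _))

/-- A bound for the integrand of `T_N` and of its expansions which shows the decay
`β^{Re v - N - 2}`, whatever the order `M`. -/
theorem norm_tailIntegrand_le (N M x : ℕ) (u v : ℂ) {β : ℝ} (hβ : 1 ≤ β) :
    ‖tailIntegrand N M x u v β‖ ≤
      ((x : ℝ) + 1) ^ |(-u - N + M).re| * β ^ (v.re - N - 2) := by
  refine (norm_cpow_mul_add_cpow_le x _ _ hβ).trans_eq ?_
  congr 2
  simp
  ring

theorem continuousOn_tailIntegrand (N M x : ℕ) (u v : ℂ) :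
    ContinuousOn (tailIntegrand N M x u v) (Ioi 0) := fun _ hβ =>
  ((hasDerivAt_ofReal_cpow hβ _).continuousAt.mul
    (hasDerivAt_natCast_add_cpow x hβ _).continuousAt).continuousWithinAt

theorem integrableOn_tailIntegrand (N M x : ℕ) (u : ℂ) {v : ℂ} (hv : v.re < (N : ℝ) + 1)
    {l : ℝ} (hl : 1 ≤ l) : IntegrableOn (tailIntegrand N M x u v) (Ioi l) := by
  refine Integrable.mono' ((integrableOn_Ioi_rpow_of_lt (a := v.re - N - 2) (by linarith)
    (by linarith : 0 < l)).const_mul (((x : ℝ) + 1) ^ |(-u - N + M).re|)) ?_ ?_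
  · exact ((continuousOn_tailIntegrand N M x u v).mono
      (Ioi_subset_Ioi (by linarith))).aestronglyMeasurable measurableSet_Ioi
  · filter_upwards [ae_restrict_mem measurableSet_Ioi] with β hβ
    exact norm_tailIntegrand_le N M x u v (hl.trans (le_of_lt hβ))

theorem summable_tailTerm (N M x : ℕ) {u v : ℂ} (hu : -(N : ℝ) + 1 < u.re)
    (hv : v.re < (N : ℝ) + 1) : Summable fun l : ℕ => tailTerm N M x u v (l + 1) := by
  set C := ((x : ℝ) + 1) ^ |(-u - N + M).re|
  refine Summable.of_norm_bounded (g := fun l : ℕ => C / (N + 1 - v.re) *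
    ((l : ℝ) + 1) ^ (-(u.re + N)))
    ((summable_nat_add_rpow one_pos (by linarith)).mul_left _) fun l => ?_
  have hl : (1 : ℝ) ≤ ((l + 1 : ℕ) : ℝ) := by exact_mod_cast Nat.le_add_left 1 l
  have hl0 : (0 : ℝ) < ((l + 1 : ℕ) : ℝ) := by linarith
  have h1 : ‖∫ β in Ioi ((l + 1 : ℕ) : ℝ), tailIntegrand N M x u v β‖ ≤
      C * (-((l + 1 : ℕ) : ℝ) ^ (v.re - N - 2 + 1) / (v.re - N - 2 + 1)) := by
    rw [← integral_Ioi_rpow_of_lt (by linarith) hl0, ← integral_const_mul]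
    refine norm_integral_le_of_norm_le
      ((integrableOn_Ioi_rpow_of_lt (by linarith) hl0).const_mul _) ?_
    filter_upwards [ae_restrict_mem measurableSet_Ioi] with β hβ
    exact norm_tailIntegrand_le N M x u v (hl.trans (le_of_lt hβ))
  have h2 : ‖((l + 1 : ℕ) : ℂ) ^ (1 - u - v)‖ = ((l + 1 : ℕ) : ℝ) ^ (1 - u.re - v.re) := by
    rw [← Complex.ofReal_natCast, Complex.norm_cpow_eq_rpow_re_of_pos hl0]
    simp
  rw [tailTerm, norm_mul, h2]
  refine (mul_le_mul_of_nonneg_left h1 (by positivity)).trans_eq ?_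
  have h3 : ((l : ℝ) + 1) ^ (-(u.re + N)) =
      ((l + 1 : ℕ) : ℝ) ^ (1 - u.re - v.re) * ((l + 1 : ℕ) : ℝ) ^ (v.re - N - 2 + 1) := by
    rw [← Real.rpow_add hl0]
    push_cast
    congr 1
    ring
  rw [h3]
  have h4 : v.re - N - 2 + 1 ≠ 0 := by linarith
  have h5 : (N : ℝ) + 1 - v.re ≠ 0 := by linarith
  field_simp
  ring

theorem summable_cpow_mul_add_cpow (N x m : ℕ) {u : ℂ} (hu : -(N : ℝ) + 1 < u.re) :
    Summable fun l : ℕ =>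
      ((l : ℂ) + 1) ^ (-(m : ℂ)) * ((x : ℂ) + ((l : ℂ) + 1)) ^ (-u - N + m) := by
  refine Summable.of_norm_bounded (g := fun l : ℕ => ((x : ℝ) + 1) ^ |(-u - N + m).re| *
    ((l : ℝ) + 1) ^ (-(u.re + N)))
    ((summable_nat_add_rpow one_pos (by linarith)).mul_left _) fun l => ?_
  have h := norm_cpow_mul_add_cpow_le x (-(m : ℂ)) (-u - N + m) (β := (l : ℝ) + 1)
    (by linarith [(l.cast_nonneg : (0 : ℝ) ≤ l)])
  push_cast at h
  refine h.trans_eq ?_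
  congr 2
  simp
  ring

theorem tendsto_rpow_atTop_zero {r : ℝ} (hr : r < 0) :
    Tendsto (fun y : ℝ => y ^ r) atTop (𝓝 0) := by
  simpa using tendsto_rpow_neg_atTop (neg_pos.2 hr)

/-- One integration by parts, raising the order of the expansion of the `l`-th term of `T_N`. -/
theorem mul_tailTerm (N M x : ℕ) (u : ℂ) {v : ℂ} (hv : v.re < (N : ℝ) + 1) (l : ℕ) :
    (u + (N - M - 1)) * tailTerm N M x u v (l + 1) =
      (u + v - M - 2) * tailTerm N (M + 1) x u v (l + 1) +
        ((l : ℂ) + 1) ^ (-((M + 1 : ℕ) : ℂ)) *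
          ((x : ℂ) + ((l : ℂ) + 1)) ^ (-u - N + (M + 1 : ℕ)) := by
  set L : ℝ := ((l + 1 : ℕ) : ℝ) with hL
  have hl : (1 : ℝ) ≤ L := by rw [hL]; exact_mod_cast Nat.le_add_left 1 l
  have hl0 : (0 : ℝ) < L := by linarith
  have hLC : (L : ℂ) = (l : ℂ) + 1 := by rw [hL]; push_cast; rfl
  set F : ℝ → ℂ := fun β =>
    (β : ℂ) ^ (u + v - M - 2) * ((x : ℂ) + β) ^ (-u - N + (M + 1 : ℕ)) with hF
  have hderiv : ∀ β : ℝ, 0 < β → HasDerivAt F ((u + v - M - 2) * tailIntegrand N (M + 1) x u v β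
      - (u + (N - M - 1)) * tailIntegrand N M x u v β) β := fun β hβ => by
    have h := (hasDerivAt_ofReal_cpow hβ (u + v - M - 2)).mul
      (hasDerivAt_natCast_add_cpow x hβ (-u - N + (M + 1 : ℕ)))
    have e : (u + v - M - 2) * (β : ℂ) ^ (u + v - M - 2 - 1) *
        ((x : ℂ) + β) ^ (-u - N + (M + 1 : ℕ)) +
        (β : ℂ) ^ (u + v - M - 2) *
          ((-u - N + (M + 1 : ℕ)) * ((x : ℂ) + β) ^ (-u - N + (M + 1 : ℕ) - 1)) =
        (u + v - M - 2) * tailIntegrand N (M + 1) x u v β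
          - (u + (N - M - 1)) * tailIntegrand N M x u v β := by
      rw [tailIntegrand, tailIntegrand,
        show u + v - M - 2 - 1 = u + v - (M + 1 : ℕ) - 2 by push_cast; ring,
        show -u - (N : ℂ) + (M + 1 : ℕ) - 1 = -u - N + M by push_cast; ring]
      push_cast
      ring
    rw [e] at h
    exact h
  have hlim : Tendsto F atTop (𝓝 0) := by
    refine squeeze_zero_norm' (a := fun β : ℝ => ((x : ℝ) + 1) ^ |(-u - N + (M + 1 : ℕ)).re| *
      β ^ (v.re - N - 1)) ?_ ?_
    · filter_upwards [eventually_ge_atTop 1] with β hβ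
      refine (norm_cpow_mul_add_cpow_le x _ _ hβ).trans_eq ?_
      congr 2
      simp
      ring
    · simpa using (tendsto_rpow_atTop_zero (r := v.re - N - 1) (by linarith)).const_mul
        (((x : ℝ) + 1) ^ |(-u - N + (M + 1 : ℕ)).re|)
  have hi0 := integrableOn_tailIntegrand N M x u hv hl
  have hi1 := integrableOn_tailIntegrand N (M + 1) x u hv hl
  have h := integral_Ioi_of_hasDerivAt_of_tendsto
    (hderiv L hl0).continuousAt.continuousWithinAt (fun β hβ => hderiv β (hl0.trans hβ))
    ((hi1.const_mul (u + v - M - 2)).sub (hi0.const_mul (u + (N - M - 1)))) hlim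
  rw [integral_sub (hi1.const_mul _) (hi0.const_mul _), integral_const_mul, integral_const_mul] at h
  have hpow : (L : ℂ) ^ (1 - u - v) * (L : ℂ) ^ (u + v - M - 2) =
      (L : ℂ) ^ (-((M + 1 : ℕ) : ℂ)) := by
    rw [← Complex.cpow_add _ _ (Complex.ofReal_ne_zero.2 hl0.ne')]
    congr 1
    push_cast
    ring
  rw [tailTerm, tailTerm, ← Complex.ofReal_natCast, ← hL, ← hLC, ← hpow]
  have hFL : F L = (L : ℂ) ^ (u + v - M - 2) * ((x : ℂ) + L) ^ (-u - N + (M + 1 : ℕ)) := rfl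
  linear_combination (-(L : ℂ) ^ (1 - u - v)) * h + (L : ℂ) ^ (1 - u - v) * hFL

theorem T_div_eq_expansion (N x : ℕ) (hx : 1 ≤ x) {u v : ℂ} (hu : -(N : ℝ) + 1 < u.re)
    (hv : v.re < (N : ℝ) + 1) (huZ : u ∉ complexIntegers) (M : ℕ) :
    T N x u v / (x : ℂ) ^ ((N : ℂ) + 1 - v) =
      (∑ m ∈ Finset.Icc 1 M,
        (-1 : ℂ) ^ (m - 1) *
          (poch (2 - u - v) ((m : ℤ) - 1) * poch u ((N : ℤ) - m) / poch (1 - v) N) *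
          ∑' l : ℕ, ((l : ℂ) + 1) ^ (-(m : ℂ)) * ((x : ℂ) + ((l : ℂ) + 1)) ^ (-u - N + m))
      + (-1 : ℂ) ^ M * (poch (2 - u - v) M * poch u ((N : ℤ) - M) / poch (1 - v) N) *
          ∑' l : ℕ, tailTerm N M x u v (l + 1) := by
  induction M with
  | zero =>
    have hx0 : (x : ℂ) ^ ((N : ℂ) + 1 - v) ≠ 0 := by
      rw [Ne, Complex.cpow_eq_zero_iff]
      rintro ⟨h, -⟩
      have : x = 0 := by exact_mod_cast h
      omega
    have h1 : poch (2 - u - v) ((0 : ℕ) : ℤ) = 1 := by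
      show ∏ j ∈ Finset.range 0, _ = (1 : ℂ)
      simp
    rw [T, h1]
    simp only [zero_lt_one, Finset.Icc_eq_empty_of_lt, Finset.sum_empty, pow_zero, Nat.cast_zero,
      sub_zero]
    field_simp
    ring
  | succ M ih =>
    rw [ih, Finset.sum_Icc_succ_top (by omega), add_assoc]
    congr 1
    have hrec : (u + (N - M - 1)) * ∑' l : ℕ, tailTerm N M x u v (l + 1) =
        (u + v - M - 2) * ∑' l : ℕ, tailTerm N (M + 1) x u v (l + 1) +
          ∑' l : ℕ, ((l : ℂ) + 1) ^ (-((M + 1 : ℕ) : ℂ)) *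
            ((x : ℂ) + ((l : ℂ) + 1)) ^ (-u - N + (M + 1 : ℕ)) := by
      rw [← tsum_mul_left, ← tsum_mul_left, ← ((summable_tailTerm N (M + 1) x hu hv).mul_left
        _).tsum_add (summable_cpow_mul_add_cpow N x (M + 1) hu)]
      exact tsum_congr fun l => mul_tailTerm N M x u hv l
    have hp1 : poch (2 - u - v) ((M + 1 : ℕ) : ℤ) = poch (2 - u - v) M * (2 - u - v + M) := by
      exact_mod_cast poch_natCast_succ (2 - u - v) M
    have hp2 : poch u ((N : ℤ) - M) = poch u ((N : ℤ) - (M + 1 : ℕ)) * (u + (N - M - 1)) := by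
      have := poch_succ huZ ((N : ℤ) - (M + 1 : ℕ))
      rw [show (N : ℤ) - (M + 1 : ℕ) + 1 = N - M by push_cast; ring] at this
      rw [this]
      push_cast
      ring
    rw [hp1, hp2, show ((M + 1 : ℕ) : ℤ) - 1 = M by push_cast; ring, Nat.add_sub_cancel, pow_succ]
    linear_combination ((-1 : ℂ) ^ M * poch (2 - u - v) M *
      poch u ((N : ℤ) - (M + 1 : ℕ)) / poch (1 - v) N) * hrec

/-! ### `T_N` as an integral over `(0, x)` of the Hurwitz series -/

theorem integrableOn_cpow_Ioo {r : ℂ} (hr : -1 < r.re) (x : ℝ) :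
    IntegrableOn (fun y : ℝ => (y : ℂ) ^ r) (Ioo 0 x) :=
  ((intervalIntegral.intervalIntegrable_cpow' hr).1.mono_set
    (Ioo_subset_Ioc_self : Ioo 0 x ⊆ Ioc 0 x))

theorem image_div_Ioi {c : ℝ} {l : ℝ} (hc : 0 < c) (hl : 0 < l) :
    (fun β : ℝ => c / β) '' Ioi l = Ioo 0 (c / l) := by
  ext y
  constructor
  · rintro ⟨β, hβ, rfl⟩
    have hβ' : l < β := hβ
    exact ⟨by have := hl.trans hβ'; positivity, div_lt_div_of_pos_left hc hl hβ'⟩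
  · rintro ⟨h0, h1⟩
    refine ⟨c / y, ?_, by field_simp⟩
    rw [lt_div_iff₀ hl] at h1
    exact (lt_div_iff₀ h0).2 (by linarith)

/-- The substitution `y = x l / β`. -/
theorem cpow_mul_tailTerm_zero {N x : ℕ} (hx : 1 ≤ x) (u v : ℂ) (l : ℕ) :
    (x : ℂ) ^ ((N : ℂ) + 1 - v) * tailTerm N 0 x u v (l + 1) =
      ∫ y in Ioo (0 : ℝ) x, (y : ℂ) ^ (N - v) * (((l : ℝ) + (y + 1) : ℝ) : ℂ) ^ (-(u + N)) := by
  set L : ℝ := ((l + 1 : ℕ) : ℝ) with hL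
  have hl0 : (0 : ℝ) < L := by rw [hL]; positivity
  have hx0 : (0 : ℝ) < x := by exact_mod_cast hx
  have hLe : (l : ℝ) + 1 = L := by rw [hL]; push_cast; rfl
  have himg := image_div_Ioi (c := x * L) (by positivity) hl0
  rw [mul_div_cancel_right₀ _ hl0.ne'] at himg
  rw [← himg, integral_image_eq_integral_abs_deriv_smul measurableSet_Ioi
    (f' := fun β => -(x * L) / β ^ 2)]
  rotate_left
  · intro β hβ
    have hβ0 : 0 < β := hl0.trans hβ
    have h := ((hasDerivAt_id' β).fun_inv hβ0.ne').const_mul (x * L)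
    rw [mul_div_assoc', mul_neg_one] at h
    exact h.hasDerivWithinAt
  · intro a ha b hb hab
    have ha0 : 0 < a := hl0.trans ha
    have hb0 : 0 < b := hl0.trans hb
    have hab' : x * L / a = x * L / b := hab
    rw [div_eq_div_iff ha0.ne' hb0.ne'] at hab'
    exact (mul_left_cancel₀ (by positivity) hab').symm
  rw [tailTerm, ← mul_assoc, ← integral_const_mul]
  refine setIntegral_congr_fun measurableSet_Ioi fun β hβ => ?_
  have hβ0 : 0 < β := hl0.trans hβ
  have hx0' : (x : ℂ) ≠ 0 := by exact_mod_cast hx0.ne'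
  have hL0' : (L : ℂ) ≠ 0 := by exact_mod_cast hl0.ne'
  have hβ0' : (β : ℂ) ≠ 0 := by exact_mod_cast hβ0.ne'
  have e1 : ((x * L / β : ℝ) : ℂ) ^ ((N : ℂ) - v) =
      (x : ℂ) ^ ((N : ℂ) - v) * (L : ℂ) ^ ((N : ℂ) - v) * (β : ℂ) ^ (-((N : ℂ) - v)) := by
    rw [div_eq_mul_inv, Complex.ofReal_mul, Complex.mul_cpow_ofReal_nonneg (by positivity)
      (by positivity), Complex.ofReal_mul, Complex.mul_cpow_ofReal_nonneg (by positivity)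
      (by positivity), Complex.ofReal_inv, Complex.inv_cpow _ _ (by
        rw [Complex.arg_ofReal_of_nonneg hβ0.le]; exact Real.pi_pos.ne), ← Complex.cpow_neg]
    simp
  have e2 : (((l : ℝ) + (x * L / β + 1) : ℝ) : ℂ) ^ (-(u + N)) =
      (L : ℂ) ^ (-(u + N)) * ((x : ℂ) + β) ^ (-(u + N)) * (β : ℂ) ^ (u + N) := by
    have : (l : ℝ) + (x * L / β + 1) = L * (x + β) * β⁻¹ := by
      rw [← hLe]; field_simp; ring
    rw [this, Complex.ofReal_mul, Complex.mul_cpow_ofReal_nonneg (by positivity)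
      (by positivity), Complex.ofReal_mul, Complex.mul_cpow_ofReal_nonneg (by positivity)
      (by positivity), Complex.ofReal_inv, Complex.inv_cpow _ _ (by
        rw [Complex.arg_ofReal_of_nonneg hβ0.le]; exact Real.pi_pos.ne), ← Complex.cpow_neg,
      neg_neg]
    simp
  have e3 : |-(x * L) / β ^ 2| = x * L / β ^ 2 := by
    rw [neg_div, abs_neg, abs_of_pos (by positivity)]
  simp only [tailIntegrand]
  have hLC : ((l + 1 : ℕ) : ℂ) = (L : ℂ) := by rw [hL]; push_cast; rfl
  rw [e1, e2, e3, Complex.real_smul, hLC]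
  have px : (x : ℂ) ^ ((N : ℂ) + 1 - v) = (x : ℂ) ^ ((N : ℂ) - v) * x := by
    rw [show (N : ℂ) + 1 - v = (N - v) + 1 by ring, Complex.cpow_add _ _ hx0', Complex.cpow_one]
  have pL : (L : ℂ) ^ (1 - u - v) = (L : ℂ) ^ ((N : ℂ) - v) * (L : ℂ) ^ (-(u + N)) * L := by
    rw [show 1 - u - v = (N - v) + (-(u + N)) + 1 by ring, Complex.cpow_add _ _ hL0',
      Complex.cpow_add _ _ hL0', Complex.cpow_one]
  have pβ : (β : ℂ) ^ (u + v - ((0 : ℕ) : ℂ) - 2) =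
      (β : ℂ) ^ (-((N : ℂ) - v)) * (β : ℂ) ^ (u + N) / β ^ 2 := by
    rw [show u + v - ((0 : ℕ) : ℂ) - 2 = -(N - v) + (u + N) - 2 by push_cast; ring,
      Complex.cpow_sub _ _ hβ0', Complex.cpow_add _ _ hβ0']
    norm_cast
  rw [px, pL, pβ, show -u - (N : ℂ) + ((0 : ℕ) : ℂ) = -(u + N) by push_cast; ring]
  push_cast
  ring

theorem hasSum_integral_Ioo {N x : ℕ} {u v : ℂ} (hu : -(N : ℝ) + 1 < u.re)
    (hv : v.re < (N : ℝ) + 1) :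
    HasSum (fun l : ℕ => ∫ y in Ioo (0 : ℝ) x,
        (y : ℂ) ^ (N - v) * (((l : ℝ) + (y + 1) : ℝ) : ℂ) ^ (-(u + N)))
      (∫ y in Ioo (0 : ℝ) x, (y : ℂ) ^ (N - v) * hurwitzSeries (u + N) (y + 1)) := by
  have hr : -1 < ((N : ℂ) - v).re := by simp; linarith
  have hint := integrableOn_cpow_Ioo hr x
  have hbound : ∀ l : ℕ, ∀ y ∈ Ioo (0 : ℝ) x,
      ‖(y : ℂ) ^ (N - v) * (((l : ℝ) + (y + 1) : ℝ) : ℂ) ^ (-(u + N))‖ ≤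
        ‖(y : ℂ) ^ (N - v)‖ * ((l : ℝ) + 1) ^ (-(u.re + N)) := fun l y hy => by
    have hy0 : 0 < y := hy.1
    rw [norm_mul, norm_nat_add_cpow (by linarith)]
    gcongr ?_ * ?_
    simp only [Complex.add_re, Complex.natCast_re]
    exact Real.rpow_le_rpow_of_nonpos (by positivity) (by linarith) (by linarith)
  have hterm : ∀ l : ℕ, IntegrableOn (fun y : ℝ => (y : ℂ) ^ (N - v) *
      (((l : ℝ) + (y + 1) : ℝ) : ℂ) ^ (-(u + N))) (Ioo (0 : ℝ) x) := fun l => by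
    refine Integrable.mono' (hint.norm.mul_const (((l : ℝ) + 1) ^ (-(u.re + N)))) ?_ ?_
    · refine hint.aestronglyMeasurable.mul (ContinuousOn.aestronglyMeasurable ?_ measurableSet_Ioo)
      intro y hy
      refine ContinuousAt.continuousWithinAt ?_
      have h0 : 0 < (l : ℝ) + (y + 1) := by have := hy.1; positivity
      exact (hasDerivAt_ofReal_cpow h0 (-(u + N))).continuousAt.comp
        (f := fun y : ℝ => (l : ℝ) + (y + 1)) (by fun_prop)
    · filter_upwards [ae_restrict_mem measurableSet_Ioo] with y hy using hbound l y hy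
  have h := hasSum_integral_of_summable_integral_norm (μ := volume.restrict (Ioo (0 : ℝ) x))
    (F := fun (l : ℕ) (y : ℝ) => (y : ℂ) ^ (N - v) * (((l : ℝ) + (y + 1) : ℝ) : ℂ) ^ (-(u + N)))
    hterm ?_
  · simp_rw [tsum_mul_left] at h
    exact h
  · refine Summable.of_nonneg_of_le (fun l => by positivity) (fun l => ?_)
      ((summable_nat_add_rpow (a := 1) (σ := u.re + N) one_pos (by linarith)).mul_left
        (∫ y in Ioo (0 : ℝ) x, ‖(y : ℂ) ^ (N - v)‖))
    rw [← integral_mul_const]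
    exact setIntegral_mono_on (hterm l).norm (hint.norm.mul_const _) measurableSet_Ioo
      (hbound l)

/-- `T_N` as an integral over a bounded interval. In this form it is visibly holomorphic in `u` and in
`v`, and it is the remainder left by the integrations by parts in `J_x`. -/
theorem T_eq_integral {N x : ℕ} (hx : 1 ≤ x) {u v : ℂ} (hu : -(N : ℝ) + 1 < u.re)
    (hv : v.re < (N : ℝ) + 1) :
    T N x u v = poch u N / poch (1 - v) N *
      ∫ y in Ioo (0 : ℝ) x, (y : ℂ) ^ (N - v) * hurwitzSeries (u + N) (y + 1) := by
  rw [T, ← (hasSum_integral_Ioo hu hv).tsum_eq, mul_div_right_comm, mul_assoc, ← tsum_mul_left]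
  simp_rw [cpow_mul_tailTerm_zero hx]

theorem integrableOn_Ioo_hurwitzSeries {N : ℕ} (x : ℝ) {u v : ℂ}
    (hu : -(N : ℝ) + 1 < u.re) (hv : v.re < (N : ℝ) + 1) :
    IntegrableOn (fun y : ℝ => (y : ℂ) ^ (N - v) * hurwitzSeries (u + N) (y + 1)) (Ioo 0 x) := by
  have hint := integrableOn_cpow_Ioo (r := N - v) (by simp; linarith) x
  have hs : 1 < (u + N).re := by simp; linarith
  refine hint.mul_bdd (c := ∑' n : ℕ, ((n : ℝ) + 1) ^ (-(u + N).re)) ?_ ?_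
  · refine ContinuousOn.aestronglyMeasurable ?_ measurableSet_Ioo
    exact (continuousOn_hurwitzSeries hs).comp (by fun_prop) fun y hy => by
      simp only [mem_Ioi]; linarith [hy.1]
  · filter_upwards [ae_restrict_mem measurableSet_Ioo] with y hy
    exact norm_hurwitzSeries_le_of_le le_rfl (by linarith [hy.1]) hs le_rfl

/-- The strip in which both variables of the formula lie. -/
def strip (N : ℕ) : Set ℂ := {s | -(N : ℝ) + 1 < s.re ∧ s.re < (N : ℝ) + 1}

theorem isOpen_strip (N : ℕ) : IsOpen (strip N) :=
  (isOpen_lt continuous_const Complex.continuous_re).inter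
    (isOpen_lt Complex.continuous_re continuous_const)

theorem differentiableOn_integral_first (N x : ℕ) {v : ℂ} (hv : v ∈ strip N) :
    DifferentiableOn ℂ (fun u : ℂ => ∫ y in Ioo (0 : ℝ) x,
      (y : ℂ) ^ (N - v) * hurwitzSeries (u + N) (y + 1)) (strip N) := by
  refine differentiableOn_integral_of_dominated (isOpen_strip N) ?_ ?_ ?_
  · filter_upwards [ae_restrict_mem measurableSet_Ioo] with y hy
    refine DifferentiableOn.const_mul ?_ _
    refine (differentiableOn_hurwitzSeries (by linarith [hy.1] : 1 ≤ y + 1)).comp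
      (f := fun u : ℂ => u + N) (by fun_prop) fun u hu => ?_
    simp only [mem_ofPred_eq, Complex.add_re, Complex.natCast_re]
    linarith [hu.1]
  · exact fun u hu => (integrableOn_Ioo_hurwitzSeries x hu.1 hv.2).aestronglyMeasurable
  · intro u hu
    obtain ⟨σ, h1, h2⟩ := exists_between (show 1 < u.re + N by linarith [hu.1])
    refine ⟨{w | σ < w.re + N}, (isOpen_lt continuous_const (by fun_prop)).mem_nhds h2,
      fun y => ‖(y : ℂ) ^ (N - v)‖ * ∑' n : ℕ, ((n : ℝ) + 1) ^ (-σ), ?_, ?_⟩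
    · exact (integrableOn_cpow_Ioo (r := N - v) (by simp; linarith [hv.2])
        x).norm.mul_const _
    · filter_upwards [ae_restrict_mem measurableSet_Ioo] with y hy w hw
      rw [norm_mul]
      gcongr
      have hw' : σ < w.re + N := hw
      exact norm_hurwitzSeries_le_of_le le_rfl (by linarith [hy.1]) h1 (by simpa using hw'.le)

theorem differentiableOn_integral_second (N x : ℕ) {v : ℂ} (hv : v ∈ strip N) :
    DifferentiableOn ℂ (fun u : ℂ => ∫ y in Ioo (0 : ℝ) x,
      (y : ℂ) ^ (N - u) * hurwitzSeries (v + N) (y + 1)) (strip N) := by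
  refine differentiableOn_integral_of_dominated (isOpen_strip N) ?_ ?_ ?_
  · filter_upwards [ae_restrict_mem measurableSet_Ioo] with y hy u hu
    have hy0 : (y : ℂ) ≠ 0 := by exact_mod_cast hy.1.ne'
    exact ((DifferentiableAt.const_cpow (by fun_prop) (Or.inl hy0)).mul_const
      _).differentiableWithinAt
  · exact fun u hu => (integrableOn_Ioo_hurwitzSeries x hv.1 hu.2).aestronglyMeasurable
  · intro u hu
    obtain ⟨σ, h1, h2⟩ := exists_between hu.2
    set C := ∑' n : ℕ, ((n : ℝ) + 1) ^ (-(v + N).re)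
    -- A power of `y > 0` is at most the sum of the powers with a smaller and a larger exponent,
    -- which dominates near `0` and for large `y` respectively.
    refine ⟨{w | w.re < σ ∧ u.re - 1 < w.re}, ((isOpen_lt Complex.continuous_re
      continuous_const).inter (isOpen_lt continuous_const Complex.continuous_re)).mem_nhds
        ⟨h1, by simp⟩, fun y => ((y ^ (N - σ)) + y ^ (N - (u.re - 1))) * C, ?_, ?_⟩
    · have hi : ∀ r : ℝ, -1 < r → IntegrableOn (fun y : ℝ => y ^ r) (Ioo 0 (x : ℝ)) := fun r hr =>
        (intervalIntegral.intervalIntegrable_rpow' hr).1.mono_set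
          (Ioo_subset_Ioc_self : Ioo 0 (x : ℝ) ⊆ Ioc 0 (x : ℝ))
      exact ((hi _ (by linarith)).add (hi _ (by linarith [hu.2]))).mul_const C
    · filter_upwards [ae_restrict_mem measurableSet_Ioo] with y hy w hw
      have hy0 : 0 < y := hy.1
      rw [norm_mul]
      refine mul_le_mul ?_ (norm_hurwitzSeries_le_of_le le_rfl (by linarith)
        (by simp; linarith [hv.1]) le_rfl) (norm_nonneg _) (by positivity)
      rw [Complex.norm_cpow_eq_rpow_re_of_pos hy0, Complex.sub_re, Complex.natCast_re]
      rcases le_total y 1 with h | h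
      · refine le_add_of_le_of_nonneg ?_ (by positivity)
        exact Real.rpow_le_rpow_of_exponent_ge hy0 h (by linarith [hw.1])
      · refine le_add_of_nonneg_of_le (by positivity) ?_
        exact Real.rpow_le_rpow_of_exponent_le h (by linarith [hw.2])

/-! ### The diagonal and off-diagonal parts of `J_x` for `Re u, Re v > 1` -/

theorem norm_cpow_mul_hurwitzSeries_le (a : ℂ) {s : ℂ} (hs : 1 < s.re) {y : ℝ} (hy : 0 < y) :
    ‖(y : ℂ) ^ a * hurwitzSeries s (y + 1)‖ ≤ y ^ (a.re + (1 - s.re)) / (s.re - 1) := by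
  rw [norm_mul, Complex.norm_cpow_eq_rpow_re_of_pos hy, Real.rpow_add hy, mul_div_assoc]
  gcongr
  exact norm_hurwitzSeries_add_one_le hs hy

theorem hasDerivAt_hurwitzSeries_add_one {s : ℂ} (hs : 1 < s.re) {y : ℝ} (hy : 0 < y) :
    HasDerivAt (fun t : ℝ => hurwitzSeries s (t + 1)) (-s * hurwitzSeries (s + 1) (y + 1)) y :=
  (hasDerivAt_hurwitzSeries hs (by linarith)).comp_add_const y 1

theorem continuousOn_cpow_mul_hurwitzSeries (a : ℂ) {s : ℂ} (hs : 1 < s.re) :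
    ContinuousOn (fun y : ℝ => (y : ℂ) ^ a * hurwitzSeries s (y + 1)) (Ioi 0) := fun _ hy =>
  ((hasDerivAt_ofReal_cpow hy a).continuousAt.mul
    (hasDerivAt_hurwitzSeries_add_one hs hy).continuousAt).continuousWithinAt

theorem integrableOn_cpow_mul_hurwitzSeries {x : ℝ} (hx : 0 < x) {a s : ℂ} (hs : 1 < s.re)
    (h : a.re + (1 - s.re) < -1) :
    IntegrableOn (fun y : ℝ => (y : ℂ) ^ a * hurwitzSeries s (y + 1)) (Ioi x) := by
  refine Integrable.mono' ((integrableOn_Ioi_rpow_of_lt h hx).div_const (s.re - 1)) ?_ ?_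
  · exact ((continuousOn_cpow_mul_hurwitzSeries a hs).mono
      (Ioi_subset_Ioi hx.le)).aestronglyMeasurable measurableSet_Ioi
  · filter_upwards [ae_restrict_mem measurableSet_Ioi] with y hy
    exact norm_cpow_mul_hurwitzSeries_le a hs (hx.trans hy)

theorem integral_Ioi_by_parts {x : ℝ} (hx : 0 < x) {u v : ℂ} (hu : 1 < u.re) (hv : 1 < v.re)
    (n : ℕ) :
    (1 - u + n) * ∫ y in Ioi x, (y : ℂ) ^ (n - u) * hurwitzSeries (v + n) (y + 1) =
      -((x : ℂ) ^ (n + 1 - u) * hurwitzSeries (v + n) (x + 1)) +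
        (v + n) * ∫ y in Ioi x, (y : ℂ) ^ ((n + 1 : ℕ) - u) *
          hurwitzSeries (v + (n + 1 : ℕ)) (y + 1) := by
  have hn : (0 : ℝ) ≤ n := n.cast_nonneg
  have hs : 1 < (v + n).re := by simp; linarith
  have hs' : 1 < (v + (n + 1 : ℕ)).re := by simp; linarith
  have hi0 := integrableOn_cpow_mul_hurwitzSeries (a := n - u) hx hs (by simp; linarith)
  have hi1 := integrableOn_cpow_mul_hurwitzSeries (a := (n + 1 : ℕ) - u) hx hs' (by simp; linarith)
  have hderiv : ∀ y : ℝ, 0 < y →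
      HasDerivAt (fun y : ℝ => (y : ℂ) ^ (n + 1 - u) * hurwitzSeries (v + n) (y + 1))
        ((1 - u + n) * ((y : ℂ) ^ (n - u) * hurwitzSeries (v + n) (y + 1)) -
          (v + n) * ((y : ℂ) ^ ((n + 1 : ℕ) - u) *
            hurwitzSeries (v + (n + 1 : ℕ)) (y + 1))) y := fun y hy => by
    have h := (hasDerivAt_ofReal_cpow hy (n + 1 - u)).mul (hasDerivAt_hurwitzSeries_add_one hs hy)
    have e : (n + 1 - u) * (y : ℂ) ^ (n + 1 - u - 1) * hurwitzSeries (v + n) (y + 1) +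
        (y : ℂ) ^ (n + 1 - u) * (-(v + n) * hurwitzSeries (v + n + 1) (y + 1)) =
        (1 - u + n) * ((y : ℂ) ^ (n - u) * hurwitzSeries (v + n) (y + 1)) -
          (v + n) * ((y : ℂ) ^ ((n + 1 : ℕ) - u) *
            hurwitzSeries (v + (n + 1 : ℕ)) (y + 1)) := by
      rw [show (n : ℂ) + 1 - u - 1 = n - u by ring, Nat.cast_succ, ← add_assoc]
      ring
    rw [e] at h
    exact h
  have hlim : Tendsto (fun y : ℝ => (y : ℂ) ^ (n + 1 - u) * hurwitzSeries (v + n) (y + 1)) atTop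
      (𝓝 0) := by
    refine squeeze_zero_norm' (a := fun y : ℝ => y ^ (2 - u.re - v.re) / ((v + n).re - 1)) ?_ ?_
    · filter_upwards [eventually_gt_atTop 0] with y hy
      refine (norm_cpow_mul_hurwitzSeries_le _ hs hy).trans_eq ?_
      congr 2
      simp
      ring
    · simpa using (tendsto_rpow_atTop_zero (r := 2 - u.re - v.re) (by linarith)).div_const
        ((v + n).re - 1)
  have h := integral_Ioi_of_hasDerivAt_of_tendsto
    (hderiv x hx).continuousAt.continuousWithinAt (fun y hy => hderiv y (hx.trans hy))
    ((hi0.const_mul _).sub (hi1.const_mul _)) hlim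
  rw [integral_sub (hi0.const_mul _) (hi1.const_mul _), integral_const_mul, integral_const_mul] at h
  linear_combination h

/-- The `N`-fold integration by parts, whose boundary terms at `x` make up `S_N(v, u; x)`. -/
theorem integral_Ioi_eq_neg_S_add {x : ℕ} (hx : 1 ≤ x) {u v : ℂ} (hu : 1 < u.re) (hv : 1 < v.re)
    (huZ : u ∉ complexIntegers) (N : ℕ) :
    ∫ y in Ioi (x : ℝ), (y : ℂ) ^ (-u) * hurwitzSeries v (y + 1) =
      -S N x v u + poch v N / poch (1 - u) N *
        ∫ y in Ioi (x : ℝ), (y : ℂ) ^ (N - u) * hurwitzSeries (v + N) (y + 1) := by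
  have hx0 : (0 : ℝ) < x := by exact_mod_cast hx
  have hu' := one_sub_notMem huZ
  induction N with
  | zero =>
    have hp : ∀ s, poch s 0 = 1 := fun s => Finset.prod_range_zero _
    simp [S, hp]
  | succ N ih =>
    have hn : (0 : ℝ) ≤ N := N.cast_nonneg
    have h := integral_Ioi_by_parts hx0 hu hv N
    have hp : poch (1 - u) ((N + 1 : ℕ) : ℤ) = poch (1 - u) N * (1 - u + N) := by
      exact_mod_cast poch_natCast_succ (1 - u) N
    have hp' : poch v ((N + 1 : ℕ) : ℤ) = poch v N * (v + N) := by
      exact_mod_cast poch_natCast_succ v N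
    have h0 : poch (1 - u) N ≠ 0 := poch_natCast_ne_zero hu' N
    have h1 : 1 - u + N ≠ 0 := by exact_mod_cast ne_intCast_of_notMem (add_natCast_notMem hu' N) 0
    have hm : modHurwitz x (v + N) 1 = hurwitzSeries (v + N) (x + 1) :=
      modHurwitz_eq_hurwitzSeries (by simp; linarith) (by simp)
    rw [ih, S, S, Finset.sum_range_succ, hm, hp', hp, show ((N : ℤ) + 1) = ((N + 1 : ℕ) : ℤ) by
      push_cast; rfl, hp]
    rw [Complex.ofReal_natCast] at h
    field_simp
    linear_combination poch v N * h

theorem J_eq_integral {x : ℕ} {u v : ℂ} (hu : 1 < u.re) (hv : 1 < v.re) :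
    J x u v = ∫ a in (x : ℝ)..x + 1, hurwitzSeries u a * hurwitzSeries v a := by
  have h := intervalIntegral.integral_comp_add_left (a := 0) (b := 1)
    (fun a => hurwitzSeries u a * hurwitzSeries v a) (x : ℝ)
  rw [add_zero] at h
  rw [← h, J]
  refine intervalIntegral.integral_congr fun α hα => ?_
  rw [uIcc_of_le zero_le_one] at hα
  simp only [modHurwitz_eq_hurwitzSeries hu hα, modHurwitz_eq_hurwitzSeries hv hα]

/-- The diagonal and the two off-diagonal parts of `J_x` in the region of absolute convergence. The
product `P(a)` of the two series satisfies `P(y) - P(y + 1) = h(y)`, where `h` is the integrand on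
the right, so `∫_x^∞ h` telescopes to `∫_x^{x+1} P`. -/
theorem J_eq_integral_Ioi {x : ℕ} (hx : 1 ≤ x) {u v : ℂ} (hu : 1 < u.re) (hv : 1 < v.re) :
    J x u v = (∫ y in Ioi (x : ℝ), (y : ℂ) ^ (-u) * hurwitzSeries v (y + 1)) +
      (∫ y in Ioi (x : ℝ), (y : ℂ) ^ (-v) * hurwitzSeries u (y + 1)) +
      (x : ℂ) ^ (1 - u - v) / (u + v - 1) := by
  have hx0 : (0 : ℝ) < x := by exact_mod_cast hx
  have hx1 : (1 : ℝ) ≤ x := by exact_mod_cast hx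
  set P : ℝ → ℂ := fun a => hurwitzSeries u a * hurwitzSeries v a
  set h : ℝ → ℂ := fun y => (y : ℂ) ^ (-u) * hurwitzSeries v (y + 1) +
    (y : ℂ) ^ (-v) * hurwitzSeries u (y + 1) + (y : ℂ) ^ (-u - v) with hh
  have hre : (-u - v).re < -1 := by simp; linarith
  have hi1 := integrableOn_cpow_mul_hurwitzSeries (a := -u) hx0 hv (by simp; linarith)
  have hi2 := integrableOn_cpow_mul_hurwitzSeries (a := -v) hx0 hu (by simp; linarith)
  have hi3 := integrableOn_Ioi_cpow_of_lt hre hx0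
  have hP : ContinuousOn P (Ioi 0) :=
    (continuousOn_hurwitzSeries hu).mul (continuousOn_hurwitzSeries hv)
  have hPint : ∀ a b : ℝ, 0 < a → a ≤ b → IntervalIntegrable P volume a b := fun a b ha hab =>
    (hP.mono (by rw [uIcc_of_le hab]; exact fun t ht => ha.trans_le ht.1)).intervalIntegrable
  have htel : ∀ K : ℕ, ∫ y in (x : ℝ)..x + K, h y = (∫ y in (x : ℝ)..x + 1, P y) -
      ∫ y in (x : ℝ) + K..x + K + 1, P y := fun K => by
    have hK : (0 : ℝ) ≤ K := K.cast_nonneg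
    have h1 : ∫ y in (x : ℝ)..x + K, h y = ∫ y in (x : ℝ)..x + K, (P y - P (y + 1)) := by
      refine intervalIntegral.integral_congr fun y hy => ?_
      rw [uIcc_of_le (by linarith)] at hy
      have hy0 : 0 < y := hx0.trans_le hy.1
      have hyC : (y : ℂ) ≠ 0 := by exact_mod_cast hy0.ne'
      simp only [hh, P]
      rw [hurwitzSeries_eq_add hu hy0, hurwitzSeries_eq_add hv hy0, sub_eq_add_neg (-u) v,
        Complex.cpow_add _ _ hyC]
      ring
    have hPs : IntervalIntegrable (fun y => P (y + 1)) volume x (x + K) :=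
      (hP.comp (by fun_prop) (by
        rw [uIcc_of_le (by linarith)]
        exact fun t ht => mem_Ioi.2 (by linarith [ht.1]))).intervalIntegrable
    rw [h1, intervalIntegral.integral_sub (hPint _ _ hx0 (by linarith)) hPs,
      intervalIntegral.integral_comp_add_right P 1]
    have h2 := intervalIntegral.integral_add_adjacent_intervals
      (hPint x (x + 1) hx0 (by linarith)) (hPint (x + 1) (x + K + 1) (by linarith) (by linarith))
    have h3 := intervalIntegral.integral_add_adjacent_intervals
      (hPint x (x + K) hx0 (by linarith)) (hPint (x + K) (x + K + 1) (by linarith) (by linarith))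
    linear_combination h3 - h2
  have hend : Tendsto (fun K : ℕ => ∫ y in (x : ℝ) + K..x + K + 1, P y) atTop (𝓝 0) := by
    refine squeeze_zero_norm' (a := fun K : ℕ => (K : ℝ) ^ (2 - u.re - v.re) /
      ((u.re - 1) * (v.re - 1))) ?_ ?_
    · filter_upwards [eventually_ge_atTop 1] with K hK
      have hK0 : (0 : ℝ) < K := by exact_mod_cast hK
      have hbound : ∀ {s : ℂ}, 1 < s.re → ∀ y : ℝ, (x : ℝ) + K < y →
          ‖hurwitzSeries s y‖ ≤ (K : ℝ) ^ (1 - s.re) / (s.re - 1) := fun {s} hs y hy => by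
        have h := norm_hurwitzSeries_add_one_le hs (y := y - 1) (by linarith)
        rw [sub_add_cancel] at h
        refine h.trans ?_
        exact div_le_div_of_nonneg_right
          (Real.rpow_le_rpow_of_nonpos hK0 (by linarith) (by linarith)) (by linarith)
      refine (intervalIntegral.norm_integral_le_of_norm_le_const
        (C := (K : ℝ) ^ (2 - u.re - v.re) / ((u.re - 1) * (v.re - 1))) fun y hy => ?_).trans_eq ?_
      · rw [uIoc_of_le (by linarith)] at hy
        rw [norm_mul, show 2 - u.re - v.re = (1 - u.re) + (1 - v.re) by ring, Real.rpow_add hK0,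
          mul_div_mul_comm]
        exact mul_le_mul (hbound hu y hy.1) (hbound hv y hy.1) (norm_nonneg _)
          (div_nonneg (by positivity) (by linarith))
      · simp
    · simpa using ((tendsto_rpow_atTop_zero (r := 2 - u.re - v.re) (by linarith)).comp
        tendsto_natCast_atTop_atTop).div_const ((u.re - 1) * (v.re - 1))
  have hlim := intervalIntegral_tendsto_integral_Ioi (x : ℝ) ((hi1.add hi2).add hi3)
    (tendsto_atTop_add_const_left atTop (x : ℝ) tendsto_natCast_atTop_atTop)
  have hlim' : Tendsto (fun K : ℕ => ∫ y in (x : ℝ)..x + K, h y) atTop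
      (𝓝 ((∫ y in (x : ℝ)..x + 1, P y) - 0)) := by
    simp_rw [htel]
    exact tendsto_const_nhds.sub hend
  have heq := tendsto_nhds_unique hlim' hlim
  have hsum : ∫ y in Ioi (x : ℝ), h y = _ := integral_add (hi1.add hi2) hi3
  have hsum' : ∫ y in Ioi (x : ℝ), ((y : ℂ) ^ (-u) * hurwitzSeries v (y + 1) +
    (y : ℂ) ^ (-v) * hurwitzSeries u (y + 1)) = _ := integral_add hi1 hi2
  rw [sub_zero] at heq
  rw [J_eq_integral hu hv]
  refine heq.trans (hsum.trans ?_)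
  rw [integral_Ioi_cpow_of_lt hre hx0]
  refine congrArg₂ (· + ·) hsum' ?_
  rw [show -u - v + 1 = -(u + v - 1) by ring, neg_div_neg_eq, Complex.ofReal_natCast,
    show 1 - u - v = -(u + v - 1) by ring]

/-! ### The beta integral and the formula for `Re u, Re v > 1` -/

theorem image_inv_one_add_Ioi : (fun t : ℝ => (1 + t)⁻¹) '' Ioi 0 = Ioo 0 1 := by
  ext y
  constructor
  · rintro ⟨t, ht, rfl⟩
    have ht0 : 0 < t := ht
    exact ⟨by positivity, inv_lt_one_of_one_lt₀ (by linarith)⟩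
  · rintro ⟨h0, h1⟩
    refine ⟨y⁻¹ - 1, ?_, by simp⟩
    have := (one_lt_inv₀ h0).2 h1
    exact mem_Ioi.2 (by linarith)

/-- Euler's beta integral over the half-line, by the substitution `t ↦ 1 / (1 + t)`. -/
theorem integral_Ioi_eq_betaIntegral {a b : ℂ} (ha : 0 < a.re) (hb : 0 < b.re) :
    IntegrableOn (fun t : ℝ => (t : ℂ) ^ (a - 1) * ((1 + t : ℝ) : ℂ) ^ (-(a + b))) (Ioi 0) ∧
      ∫ t in Ioi (0 : ℝ), (t : ℂ) ^ (a - 1) * ((1 + t : ℝ) : ℂ) ^ (-(a + b)) =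
        Complex.betaIntegral b a := by
  set g : ℝ → ℂ := fun y => (y : ℂ) ^ (b - 1) * (1 - (y : ℂ)) ^ (a - 1)
  have hderiv : ∀ t ∈ Ioi (0 : ℝ),
      HasDerivWithinAt (fun t : ℝ => (1 + t)⁻¹) (-1 / (1 + t) ^ 2) (Ioi 0) t := fun t ht => by
    have ht0 : 0 < t := ht
    exact (((hasDerivAt_id' t).const_add 1).fun_inv (by positivity)).hasDerivWithinAt
  have hinj : InjOn (fun t : ℝ => (1 + t)⁻¹) (Ioi 0) := fun s _ t _ hst => by
    have := inv_injective hst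
    linarith
  have hcongr : EqOn (fun t : ℝ => |-1 / (1 + t) ^ 2| • g ((1 + t)⁻¹))
      (fun t : ℝ => (t : ℂ) ^ (a - 1) * ((1 + t : ℝ) : ℂ) ^ (-(a + b))) (Ioi 0) := fun t ht => by
    have ht0 : 0 < t := ht
    set w : ℝ := 1 + t with hw
    have hw0 : 0 < w := by rw [hw]; positivity
    have hwC : (w : ℂ) ≠ 0 := by exact_mod_cast hw0.ne'
    have harg : (w : ℂ).arg ≠ Real.pi := by
      rw [Complex.arg_ofReal_of_nonneg hw0.le]; exact Real.pi_pos.ne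
    have h1 : 1 - ((w⁻¹ : ℝ) : ℂ) = ((t * w⁻¹ : ℝ) : ℂ) := by
      rw [show t = w - 1 by rw [hw]; ring]
      push_cast
      field_simp
    simp only [g, ← hw]
    rw [h1, neg_div, abs_neg, abs_of_pos (by positivity), Complex.ofReal_mul,
      Complex.mul_cpow_ofReal_nonneg ht0.le (by positivity), Complex.ofReal_inv,
      Complex.inv_cpow _ _ harg, Complex.inv_cpow _ _ harg, ← Complex.cpow_neg,
      ← Complex.cpow_neg, Complex.real_smul,
      show -(a + b) = -(b - 1) + -(a - 1) - 2 by ring, Complex.cpow_sub _ _ hwC,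
      Complex.cpow_add _ _ hwC]
    push_cast
    rw [show (w : ℂ) ^ (2 : ℂ) = (w : ℂ) ^ 2 by norm_cast]
    ring
  have hint : IntegrableOn g (Ioo 0 1) :=
    (Complex.betaIntegral_convergent hb ha).1.mono_set Ioo_subset_Ioc_self
  constructor
  · rw [← image_inv_one_add_Ioi,
      integrableOn_image_iff_integrableOn_abs_deriv_smul measurableSet_Ioi hderiv hinj] at hint
    exact hint.congr_fun hcongr measurableSet_Ioi
  · rw [Complex.betaIntegral, intervalIntegral.integral_of_le zero_le_one,
      integral_Ioc_eq_integral_Ioo, ← image_inv_one_add_Ioi,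
      integral_image_eq_integral_abs_deriv_smul measurableSet_Ioi hderiv hinj]
    exact (setIntegral_congr_fun measurableSet_Ioi hcongr).symm

theorem scaled_beta_integrand {a b : ℂ} {l t : ℝ} (hl : 0 < l) (ht : 0 < t) :
    ((l * t : ℝ) : ℂ) ^ (a - 1) * ((l + l * t : ℝ) : ℂ) ^ (-(a + b)) =
      (l : ℂ) ^ (-b - 1) * ((t : ℂ) ^ (a - 1) * ((1 + t : ℝ) : ℂ) ^ (-(a + b))) := by
  have hlC : (l : ℂ) ≠ 0 := by exact_mod_cast hl.ne'
  rw [show l + l * t = l * (1 + t) by ring, Complex.ofReal_mul, Complex.ofReal_mul,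
    Complex.mul_cpow_ofReal_nonneg hl.le ht.le,
    Complex.mul_cpow_ofReal_nonneg hl.le (by positivity),
    show -b - 1 = (a - 1) + -(a + b) by ring, Complex.cpow_add _ _ hlC]
  ring

/-- The Mellin transform of `y ↦ ∑_{l ≥ 1} (y + l)^{-s}`, integrated termwise: the `l`-th term
contributes `l^{-b} B(b, a)`. -/
theorem integral_Ioi_zero_hurwitzSeries {a b : ℂ} (ha : 0 < a.re) (hb : 1 < b.re) :
    ∫ y in Ioi (0 : ℝ), (y : ℂ) ^ (a - 1) * hurwitzSeries (a + b) (y + 1) =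
      riemannZeta b * Complex.betaIntegral b a := by
  obtain ⟨hk, hkI⟩ := integral_Ioi_eq_betaIntegral ha (by linarith : 0 < b.re)
  set k : ℝ → ℂ := fun t => (t : ℂ) ^ (a - 1) * ((1 + t : ℝ) : ℂ) ^ (-(a + b)) with hkdef
  set g : ℕ → ℝ → ℂ := fun n y =>
    (y : ℂ) ^ (a - 1) * (((n : ℝ) + (y + 1) : ℝ) : ℂ) ^ (-(a + b)) with hgdef
  have hl : ∀ n : ℕ, (0 : ℝ) < n + 1 := fun n => by positivity
  have hscale : ∀ n : ℕ, EqOn (fun t => g n ((n + 1) * t))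
      (fun t => (((n : ℝ) + 1 : ℝ) : ℂ) ^ (-b - 1) * k t) (Ioi 0) := fun n t ht => by
    simp only [hgdef]
    rw [show (n : ℝ) + ((n + 1) * t + 1) = (n + 1) + (n + 1) * t by ring]
    exact scaled_beta_integrand (hl n) ht
  have hgint : ∀ n, IntegrableOn (g n) (Ioi 0) := fun n => by
    have h := integrableOn_Ioi_comp_mul_left_iff (g n) 0 (hl n)
    rw [mul_zero] at h
    exact h.1 (IntegrableOn.congr_fun (hk.const_mul _) (hscale n).symm measurableSet_Ioi)
  have hgI : ∀ n, ∫ y in Ioi (0 : ℝ), g n y =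
      (1 / ((n : ℂ) + 1) ^ b) * Complex.betaIntegral b a := fun n => by
    have h := integral_comp_mul_left_Ioi (g n) 0 (hl n)
    rw [mul_zero, setIntegral_congr_fun measurableSet_Ioi (hscale n), integral_const_mul, hkI,
      Complex.real_smul] at h
    have hn : ((n : ℂ) + 1) ≠ 0 := by exact_mod_cast (hl n).ne'
    push_cast at h
    rw [Complex.cpow_sub _ _ hn, Complex.cpow_one, Complex.cpow_neg] at h
    field_simp at h
    field_simp
    rw [h, mul_comm]
  have hgN : ∀ n, ∫ y in Ioi (0 : ℝ), ‖g n y‖ =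
      ((n : ℝ) + 1) ^ (-b.re) * ∫ t in Ioi (0 : ℝ), ‖k t‖ := fun n => by
    have h := integral_comp_mul_left_Ioi (fun y => ‖g n y‖) 0 (hl n)
    rw [mul_zero, setIntegral_congr_fun (g := fun t => ((n : ℝ) + 1) ^ (-b.re - 1) * ‖k t‖)
      measurableSet_Ioi (fun t ht => by
        have h1 := hscale n ht
        simp only at h1
        simp only
        rw [h1, norm_mul, Complex.norm_cpow_eq_rpow_re_of_pos (hl n)]
        simp), integral_const_mul, smul_eq_mul, Real.rpow_sub_one (hl n).ne'] at h
    have hn := (hl n).ne'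
    field_simp at h
    exact h.symm
  have hsum := hasSum_integral_of_summable_integral_norm (μ := volume.restrict (Ioi (0 : ℝ)))
    (F := g) hgint (by
      simp_rw [hgN]
      exact (summable_nat_add_rpow one_pos hb).mul_right _)
  have htsum : ∀ y : ℝ, ∑' n, g n y = (y : ℂ) ^ (a - 1) * hurwitzSeries (a + b) (y + 1) :=
    fun y => by rw [hgdef]; exact tsum_mul_left
  simp_rw [htsum] at hsum
  rw [← hsum.tsum_eq]
  simp_rw [hgI]
  rw [tsum_mul_right, zeta_eq_tsum_one_div_nat_add_one_cpow hb]

theorem Gamma_add_natCast {s : ℂ} (hs : s ∉ complexIntegers) (n : ℕ) :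
    Complex.Gamma (s + n) = poch s n * Complex.Gamma s := by
  induction n with
  | zero =>
    have hp : poch s 0 = 1 := Finset.prod_range_zero _
    simp [hp]
  | succ n ih =>
    have h0 : s + n ≠ 0 := by exact_mod_cast ne_intCast_of_notMem (add_natCast_notMem hs n) 0
    have hp : poch s ((n + 1 : ℕ) : ℤ) = poch s n * (s + n) := by
      exact_mod_cast poch_natCast_succ s n
    rw [hp, Nat.cast_succ, ← add_assoc, Complex.Gamma_add_one _ h0, ih]
    ring

theorem Gamma_ne_zero_of_notMem {s : ℂ} (hs : s ∉ complexIntegers) : Complex.Gamma s ≠ 0 := by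
  refine Complex.Gamma_ne_zero fun m => ?_
  exact_mod_cast ne_intCast_of_notMem hs (-m)

/-- The off-diagonal part of `J_x` in the region of absolute convergence. -/
theorem integral_Ioi_eq {N x : ℕ} (hx : 1 ≤ x) {u v : ℂ} (hu : 1 < u.re)
    (hu' : u.re < (N : ℝ) + 1) (hv : 1 < v.re)
    (huZ : u ∉ complexIntegers) (hvZ : v ∉ complexIntegers) :
    ∫ y in Ioi (x : ℝ), (y : ℂ) ^ (-u) * hurwitzSeries v (y + 1) =
      Complex.Gamma (1 - u) / Complex.Gamma v * Complex.Gamma (u + v - 1) *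
        riemannZeta (u + v - 1) - S N x v u - T N x v u := by
  have hx0 : (0 : ℝ) < x := by exact_mod_cast hx
  have hn : (0 : ℝ) ≤ N := N.cast_nonneg
  have hvN : -(N : ℝ) + 1 < v.re := by linarith
  have hI1 := integrableOn_Ioo_hurwitzSeries (x : ℝ) hvN hu'
  have hI2 : IntegrableOn (fun y : ℝ => (y : ℂ) ^ (N - u) * hurwitzSeries (v + N) (y + 1))
      (Ici (x : ℝ)) :=
    (integrableOn_Ici_iff_integrableOn_Ioi enorm_ne_top).2 (integrableOn_cpow_mul_hurwitzSeries hx0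
      (by simp; linarith) (by simp; linarith))
  have hsplit := setIntegral_union (μ := volume) (s := Ioo 0 (x : ℝ)) (t := Ici (x : ℝ))
    (by rw [disjoint_left]; exact fun y hy hy' => absurd hy.2 (not_lt.2 hy')) measurableSet_Ici
    hI1 hI2
  rw [Ioo_union_Ici_eq_Ioi hx0, integral_Ici_eq_integral_Ioi] at hsplit
  have hmellin := integral_Ioi_zero_hurwitzSeries (a := N + 1 - u) (b := u + v - 1)
    (by simp; linarith) (by simp; linarith)
  rw [show (N : ℂ) + 1 - u - 1 = N - u by ring,
    show (N : ℂ) + 1 - u + (u + v - 1) = v + N by ring] at hmellin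
  have hbeta := Complex.Gamma_mul_Gamma_eq_betaIntegral (s := u + v - 1) (t := N + 1 - u)
    (by simp; linarith) (by simp; linarith)
  rw [show u + v - 1 + ((N : ℂ) + 1 - u) = v + N by ring,
    show (N : ℂ) + 1 - u = 1 - u + N by ring, Gamma_add_natCast hvZ,
    Gamma_add_natCast (one_sub_notMem huZ)] at hbeta
  rw [show (N : ℂ) + 1 - u = 1 - u + N by ring] at hmellin
  rw [integral_Ioi_eq_neg_S_add hx hu hv huZ N, T_eq_integral hx hvN hu']
  have h1 := poch_natCast_ne_zero (one_sub_notMem huZ) N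
  have h2 := poch_natCast_ne_zero hvZ N
  have h3 := Gamma_ne_zero_of_notMem hvZ
  rw [hsplit] at hmellin
  field_simp
  linear_combination poch v N * Complex.Gamma v * hmellin - riemannZeta (u + v - 1) * hbeta

/-- The formula for `J_x` in the region where both series converge absolutely. -/
theorem J_eq_of_one_lt {N x : ℕ} (hx : 1 ≤ x) {u v : ℂ} (hu : 1 < u.re)
    (hu' : u.re < (N : ℝ) + 1) (hv : 1 < v.re) (hv' : v.re < (N : ℝ) + 1)
    (huZ : u ∉ complexIntegers) (hvZ : v ∉ complexIntegers) :
    J x u v = (x : ℂ) ^ (1 - u - v) / (u + v - 1)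
      + (Complex.Gamma (1 - u) / Complex.Gamma v + Complex.Gamma (1 - v) / Complex.Gamma u)
        * Complex.Gamma (u + v - 1) * riemannZeta (u + v - 1)
      - S N x u v - S N x v u - T N x u v - T N x v u := by
  rw [J_eq_integral_Ioi hx hu hv, integral_Ioi_eq hx hu hu' hv huZ hvZ,
    integral_Ioi_eq hx hv hv' hu hvZ huZ, show v + u - 1 = u + v - 1 by ring]
  ring

/-! ### Analytic continuation to the strip -/

/-- The right-hand side of the formula for `J_x(u, v)`. -/
noncomputable def closedForm (N x : ℕ) (u v : ℂ) : ℂ :=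
  (x : ℂ) ^ (1 - u - v) / (u + v - 1)
    + (Complex.Gamma (1 - u) / Complex.Gamma v + Complex.Gamma (1 - v) / Complex.Gamma u)
      * Complex.Gamma (u + v - 1) * riemannZeta (u + v - 1)
    - S N x u v - S N x v u - T N x u v - T N x v u

theorem closedForm_comm (N x : ℕ) (u v : ℂ) : closedForm N x u v = closedForm N x v u := by
  rw [closedForm, closedForm, sub_right_comm 1 u v, add_comm u v]
  ring

theorem J_comm (x : ℕ) (u v : ℂ) : J x u v = J x v u := by
  simp only [J, mul_comm]

/-- The exceptional values of `u` for a given non-integral `v`. -/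
def exceptionalFibre (v : ℂ) : Set ℂ :=
  complexIntegers ∪ (· + v) ⁻¹' ((fun k : ℤ => (k : ℂ)) '' Iic 2)

theorem isClosed_exceptionalFibre (v : ℂ) : IsClosed (exceptionalFibre v) :=
  isClosed_complexIntegers.union
    ((isClosed_image_intCast _).preimage (by fun_prop))

theorem countable_exceptionalFibre (v : ℂ) : (exceptionalFibre v).Countable :=
  countable_complexIntegers.union
    (((to_countable (Iic (2 : ℤ))).image _).preimage (add_left_injective v))

theorem notMem_exceptional_iff {u v : ℂ} :
    (u, v) ∉ exceptional ↔ u ∉ exceptionalFibre v ∧ v ∉ complexIntegers := by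
  simp only [exceptional, exceptionalFibre, complexIntegers, mem_union, mem_preimage, mem_image,
    mem_univ, true_and, mem_Iic, mem_ofPred_eq, eq_comm]
  rw [← not_or, or_assoc, or_left_comm]

theorem exceptionalFibre_symm {u v : ℂ} (hu : u ∉ exceptionalFibre v) (hv : v ∉ complexIntegers) :
    v ∉ exceptionalFibre u := by
  rintro (h | h)
  · exact hv h
  · exact hu (Or.inr (by rw [mem_preimage, add_comm]; exact h))

theorem add_ne_of_notMem {u v : ℂ} (hu : u ∉ exceptionalFibre v) {k : ℤ} (hk : k ≤ 2) :
    u + v ≠ k := fun h => hu (Or.inr ⟨k, hk, h.symm⟩)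

theorem differentiable_poch (n : ℕ) : Differentiable ℂ fun s => poch s n := by
  show Differentiable ℂ fun s : ℂ => ∏ j ∈ Finset.range n, (s + j)
  fun_prop

theorem differentiableAt_Gamma_of_notMem {s : ℂ} (hs : s ∉ complexIntegers) :
    DifferentiableAt ℂ Complex.Gamma s := by
  refine Complex.differentiableAt_Gamma s fun m => ?_
  exact_mod_cast ne_intCast_of_notMem hs (-m)

theorem natCast_ne_zero_of_one_le {x : ℕ} (hx : 1 ≤ x) : (x : ℂ) ≠ 0 := by
  exact_mod_cast (by omega : x ≠ 0)

theorem differentiableAt_modHurwitz_add (x n : ℕ) {u : ℂ} (hu : u ∉ complexIntegers) (α : ℝ) :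
    DifferentiableAt ℂ (fun u => modHurwitz x (u + n) α) u := by
  have hun := add_natCast_notMem hu n
  exact (differentiableAt_modHurwitz x α (by exact_mod_cast ne_intCast_of_notMem hun 0)
    (by exact_mod_cast ne_intCast_of_notMem hun 1)).comp u (f := fun u : ℂ => u + n) (by fun_prop)

theorem differentiableAt_S_first (N x : ℕ) {u : ℂ} (hu : u ∉ complexIntegers) (v : ℂ) :
    DifferentiableAt ℂ (fun u => S N x u v) u := by
  unfold S
  refine DifferentiableAt.fun_sum fun n _ => ?_
  exact (((differentiable_poch n u).mul_const _).div_const _).mul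
    (differentiableAt_modHurwitz_add x n hu 1)

theorem differentiableAt_S_second (N : ℕ) {x : ℕ} (hx : 1 ≤ x) {u : ℂ} (hu : u ∉ complexIntegers)
    (v : ℂ) : DifferentiableAt ℂ (fun u => S N x v u) u := by
  unfold S
  refine DifferentiableAt.fun_sum fun n _ => ?_
  have h1 : DifferentiableAt ℂ (fun u : ℂ => (x : ℂ) ^ ((n : ℂ) + 1 - u)) u :=
    DifferentiableAt.const_cpow (by fun_prop) (Or.inl (natCast_ne_zero_of_one_le hx))
  have h2 : DifferentiableAt ℂ (fun u : ℂ => poch (1 - u) ((n + 1 : ℕ) : ℤ)) u :=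
    (differentiable_poch (n + 1) (1 - u)).comp u (f := fun u : ℂ => 1 - u) (by fun_prop)
  exact ((h1.const_mul _).div h2 (poch_natCast_ne_zero (one_sub_notMem hu) (n + 1))).mul_const _

theorem differentiableAt_T_first {N x : ℕ} (hx : 1 ≤ x) {u v : ℂ} (hu : u ∈ strip N)
    (hv : v ∈ strip N) : DifferentiableAt ℂ (fun u => T N x u v) u := by
  have hnhds := (isOpen_strip N).mem_nhds hu
  refine DifferentiableAt.congr_of_eventuallyEq (f := fun u => poch u N / poch (1 - v) N *
    ∫ y in Ioo (0 : ℝ) x, (y : ℂ) ^ (N - v) * hurwitzSeries (u + N) (y + 1)) ?_ ?_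
  · exact ((differentiable_poch N u).div_const _).mul
      ((differentiableOn_integral_first N x hv).differentiableAt hnhds)
  · filter_upwards [hnhds] with w hw using T_eq_integral hx hw.1 hv.2

theorem differentiableAt_T_second {N x : ℕ} (hx : 1 ≤ x) {u v : ℂ} (hu : u ∈ strip N)
    (hv : v ∈ strip N) (huZ : u ∉ complexIntegers) :
    DifferentiableAt ℂ (fun u => T N x v u) u := by
  have hnhds := (isOpen_strip N).mem_nhds hu
  refine DifferentiableAt.congr_of_eventuallyEq (f := fun u => poch v N / poch (1 - u) N *
    ∫ y in Ioo (0 : ℝ) x, (y : ℂ) ^ (N - u) * hurwitzSeries (v + N) (y + 1)) ?_ ?_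
  · have h2 : DifferentiableAt ℂ (fun u : ℂ => poch (1 - u) N) u :=
      (differentiable_poch N (1 - u)).comp u (f := fun u : ℂ => 1 - u) (by fun_prop)
    exact (((differentiableAt_const _).div h2 (poch_natCast_ne_zero (one_sub_notMem huZ) N))).mul
      ((differentiableOn_integral_second N x hv).differentiableAt hnhds)
  · filter_upwards [hnhds] with w hw using T_eq_integral hx hv.1 hw.2

theorem differentiableAt_J {x : ℕ} (hx : 1 ≤ x) {u v : ℂ} (hu : u ∉ complexIntegers)
    (hv : v ∉ complexIntegers) : DifferentiableAt ℂ (fun u => J x u v) u :=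
  (differentiableOn_integral_of_regularAt isClosed_complexIntegers.isOpen_compl (fun _ h => h)
    (fun _ h => regularAt hx h) (right_mem_Icc.2 zero_le_one)
    (regularAt hx hv).2).differentiableAt (isClosed_complexIntegers.isOpen_compl.mem_nhds hu)

theorem differentiableAt_closedForm {N x : ℕ} (hx : 1 ≤ x) {u v : ℂ} (hu : u ∈ strip N)
    (hv : v ∈ strip N) (huE : u ∉ exceptionalFibre v) :
    DifferentiableAt ℂ (fun u => closedForm N x u v) u := by
  have huZ : u ∉ complexIntegers := fun h => huE (Or.inl h)
  have hsum : ∀ m : ℕ, u + v - 1 ≠ -m := fun m h => by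
    refine add_ne_of_notMem huE (k := 1 - m) (by omega) ?_
    push_cast
    linear_combination h
  have h1 : u + v - 1 ≠ 0 := by simpa using hsum 0
  have h2 : u + v - 1 ≠ 1 := fun h => by
    refine add_ne_of_notMem huE (k := 2) le_rfl ?_
    push_cast
    linear_combination h
  have d0 : DifferentiableAt ℂ (fun u : ℂ => u + v - 1) u := by fun_prop
  have dx : DifferentiableAt ℂ (fun u : ℂ => (x : ℂ) ^ (1 - u - v)) u :=
    DifferentiableAt.const_cpow (by fun_prop) (Or.inl (natCast_ne_zero_of_one_le hx))
  have dG : DifferentiableAt ℂ (fun u : ℂ => Complex.Gamma (1 - u)) u :=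
    (differentiableAt_Gamma_of_notMem (one_sub_notMem huZ)).comp u (f := fun u : ℂ => 1 - u)
      (by fun_prop)
  have dGs : DifferentiableAt ℂ (fun u : ℂ => Complex.Gamma (u + v - 1)) u :=
    (Complex.differentiableAt_Gamma _ hsum).comp u (f := fun u : ℂ => u + v - 1) d0
  have dz : DifferentiableAt ℂ (fun u : ℂ => riemannZeta (u + v - 1)) u :=
    (differentiableAt_riemannZeta h2).comp u (f := fun u : ℂ => u + v - 1) d0
  have dq : DifferentiableAt ℂ (fun u : ℂ => Complex.Gamma (1 - v) / Complex.Gamma u) u :=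
    (differentiableAt_const _).div (differentiableAt_Gamma_of_notMem huZ)
      (Gamma_ne_zero_of_notMem huZ)
  exact ((((((dx.div d0 h1).add ((((dG.div_const _).add dq).mul dGs).mul dz)).sub
    (differentiableAt_S_first N x huZ v)).sub (differentiableAt_S_second N hx huZ v)).sub
    (differentiableAt_T_first hx hu hv)).sub (differentiableAt_T_second hx hu hv huZ))

/-- Continuation in the first variable: validity of the formula for `Re u > 1` implies it on the
whole strip. The disc used has its centre on `Re w = 1` and spans the strip. -/
theorem J_eq_closedForm_of_right {N x : ℕ} (hx : 1 ≤ x) {v : ℂ} (hv : v ∈ strip N)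
    (hvZ : v ∉ complexIntegers)
    (h : ∀ u ∈ strip N, u ∉ exceptionalFibre v → 1 < u.re → J x u v = closedForm N x u v)
    {u : ℂ} (hu : u ∈ strip N) (huE : u ∉ exceptionalFibre v) :
    J x u v = closedForm N x u v := by
  set c : ℂ := ⟨1, u.im⟩
  have hball : Metric.ball c N ⊆ strip N := fun w hw => by
    rw [Metric.mem_ball, dist_eq_norm] at hw
    have h := abs_le.1 (Complex.abs_re_le_norm (w - c))
    have : (w - c).re = w.re - 1 := rfl
    exact ⟨by linarith [h.1], by linarith [h.2]⟩
  have hmem : u ∈ Metric.ball c N := by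
    rw [Metric.mem_ball, Complex.dist_of_im_eq (show u.im = c.im from rfl), Real.dist_eq, abs_lt]
    show -(N : ℝ) < u.re - 1 ∧ u.re - 1 < N
    exact ⟨by linarith [hu.1], by linarith [hu.2]⟩
  refine sub_eq_zero.1 (eq_zero_of_eq_zero_right (f := fun w => J x w v - closedForm N x w v)
    (countable_exceptionalFibre v) (isClosed_exceptionalFibre v) (fun w hw => ?_) (fun w hw hw1 =>
      sub_eq_zero.2 (h w (hball hw.1) hw.2 hw1)) ⟨hmem, huE⟩)
  exact ((differentiableAt_J hx (fun h => hw.2 (Or.inl h)) hvZ).sub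
    (differentiableAt_closedForm hx (hball hw.1) hv hw.2)).differentiableWithinAt

theorem J_eq_closedForm {N x : ℕ} (hx : 1 ≤ x) {u v : ℂ} (hu : u ∈ strip N) (hv : v ∈ strip N)
    (huE : u ∉ exceptionalFibre v) (hvZ : v ∉ complexIntegers) :
    J x u v = closedForm N x u v := by
  have huZ : u ∉ complexIntegers := fun h => huE (Or.inl h)
  rw [J_comm, closedForm_comm]
  refine J_eq_closedForm_of_right hx hu huZ (fun w hw hwE hw1 => ?_) hv
    (exceptionalFibre_symm huE hvZ)
  have hwZ : w ∉ complexIntegers := fun h => hwE (Or.inl h)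
  rw [J_comm, closedForm_comm]
  refine J_eq_closedForm_of_right hx hw hwZ (fun z hz hzE hz1 => ?_) hu
    (exceptionalFibre_symm hwE huZ)
  exact J_eq_of_one_lt hx hz1 hz.2 hw1 hw.2 (fun h => hzE (Or.inl h)) hwZ

end HurwitzMean

open HurwitzMean in
theorem theorem1 (N x : ℕ) (hN : 1 ≤ N) (hx : 1 ≤ x) (u v : ℂ)
    (hu : -(N : ℝ) + 1 < u.re) (hu' : u.re < (N : ℝ) + 1)
    (hv : -(N : ℝ) + 1 < v.re) (hv' : v.re < (N : ℝ) + 1)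
    (hE : (u, v) ∉ exceptional) :
    -- the integral defining `J_x(u, v)` converges
    IntervalIntegrable (fun α : ℝ => modHurwitz x u α * modHurwitz x v α)
      MeasureTheory.volume 0 1 ∧
    -- the integrals and the series over `l ≥ 1` below converge absolutely
    (∀ M l : ℕ, MeasureTheory.IntegrableOn (tailIntegrand N M x u v)
      (Set.Ioi (((l + 1 : ℕ) : ℝ)))) ∧
    (∀ M l : ℕ, MeasureTheory.IntegrableOn (tailIntegrand N M x v u)
      (Set.Ioi (((l + 1 : ℕ) : ℝ)))) ∧
    (∀ M : ℕ, Summable fun l : ℕ => tailTerm N M x u v (l + 1)) ∧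
    (∀ M : ℕ, Summable fun l : ℕ => tailTerm N M x v u (l + 1)) ∧
    (∀ m : ℕ, Summable fun l : ℕ =>
      ((l : ℂ) + 1) ^ (-(m : ℂ)) * ((x : ℂ) + ((l : ℂ) + 1)) ^ (-u - N + m)) ∧
    -- the formula for `J_x(u, v)`
    J x u v = (x : ℂ) ^ (1 - u - v) / (u + v - 1)
      + (Complex.Gamma (1 - u) / Complex.Gamma v + Complex.Gamma (1 - v) / Complex.Gamma u)
        * Complex.Gamma (u + v - 1) * riemannZeta (u + v - 1)
      - S N x u v - S N x v u - T N x u v - T N x v u ∧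
    -- the expansion of `T_N(u, v; x)` to any order `M ≥ 0`
    (∀ M : ℕ, T N x u v / (x : ℂ) ^ ((N : ℂ) + 1 - v) =
      (∑ m ∈ Finset.Icc 1 M,
        (-1 : ℂ) ^ (m - 1) *
          (poch (2 - u - v) ((m : ℤ) - 1) * poch u ((N : ℤ) - m) / poch (1 - v) N) *
          ∑' l : ℕ, ((l : ℂ) + 1) ^ (-(m : ℂ)) * ((x : ℂ) + ((l : ℂ) + 1)) ^ (-u - N + m))
      + (-1 : ℂ) ^ M * (poch (2 - u - v) M * poch u ((N : ℤ) - M) / poch (1 - v) N) *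
          ∑' l : ℕ, tailTerm N M x u v (l + 1)) := by
  obtain ⟨huE, hvZ⟩ := notMem_exceptional_iff.1 hE
  have huZ : u ∉ complexIntegers := fun h => huE (Or.inl h)
  have hl : ∀ l : ℕ, (1 : ℝ) ≤ ((l + 1 : ℕ) : ℝ) := fun l => by exact_mod_cast Nat.le_add_left 1 l
  refine ⟨?_, fun M l => integrableOn_tailIntegrand N M x u hv' (hl l),
    fun M l => integrableOn_tailIntegrand N M x v hu' (hl l),
    fun M => summable_tailTerm N M x hu hv', fun M => summable_tailTerm N M x hv hu',
    fun m => summable_cpow_mul_add_cpow N x m hu,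
    J_eq_closedForm hx ⟨hu, hu'⟩ ⟨hv, hv'⟩ huE hvZ,
    fun M => T_div_eq_expansion N x hx hu hv' huZ M⟩
  refine ContinuousOn.intervalIntegrable ?_
  rw [Set.uIcc_of_le zero_le_one]
  exact (regularAt hx huZ).2.mul (regularAt hx hvZ).2
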